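/- Let $L>0$ and $V=H^2(0,L;\mathbb{R}^3)\times H^1(0,L;\mathbb{R}^3)$. Let $L_{\rm bc}$ be a bounded linear operator from $V$ to a real normed space such that $L_{\rm bc}[y,b]$ depends only on the boundary values of $y$, $y'$ and $b$ at $0$ and $L$, and let $\ell_{\rm bc}$ be given. Set \[ \overline Q(\alpha,\beta)=\begin{cases}(\alpha^2+\beta^2)^2/\alpha^2,&|\alpha|\ge|\beta|,\\ 4\beta^2,&|\alpha|\le|\beta|,\end{cases}\qquad \overline Q(0,0)=0 . \] For $\delta\ge 0$ let $|\cdot|_\delta:\mathbb{R}\to\mathbb{R}_{\ge0}$ be given with $\big||x|_\delta-|x|\big|\le c_{\rm uni}\delta$ for all $x\in\mathbb{R}$ (so $|\cdot|_0=|\cdot|$) and, for $\delta>0$, $|\cdot|_\delta\in C^2(\mathbb{R})$, $|\cdot|_\delta\ge c_0\delta$, $|\cdot|_\delta'\le c_1$, $|\cdot|_\delta''\le c_2\delta^{-1}$, where $c_0>0$ and the constants do not depend on $\delta$. Set \[ \overline Q_\delta(\alpha,\beta)=2\beta^2+\tfrac12\alpha^2+\tfrac12\beta^2+\tfrac12|\alpha^2-\beta^2|_\delta+\frac{2\beta^4}{\alpha^2+\beta^2+|\alpha^2-\beta^2|_\delta},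 \] where the last term is read as $0$ if its denominator vanishes; thus $\overline Q_0=\overline Q$. For $\varepsilon_2>0$ let $E_{0,\varepsilon_2}:V\to[0,\infty]$ be \[ E_{0,\varepsilon_2}[y,b]=\int_0^L\overline Q(|y''|,|b'|)\,dx+\frac1{2\varepsilon_2}\int_0^L(y'\cdot b')^2\,dx \] if $[y',b,y'\times b]\in SO(3)$ a.e. in $(0,L)$ and $L_{\rm bc}[y,b]=\ell_{\rm bc}$, and $E_{0,\varepsilon_2}[y,b]=+\infty$ otherwise. For a partitioning $\mathcal{T}$ of $[0,L]$ given by nodes $0=x_0<\dots<x_N=L$, with maximal mesh-size $h$, let $\mathcal{S}^{p,k}(\mathcal{T})$ be the space of $C^k$ functions that are polynomials of degree at most $p$ on each element $[x_{j-1},x_j]$. For $\varepsilon=(\varepsilon_1,\varepsilon_2)$ with $\varepsilon_1,\varepsilon_2>0$ let $E_{\delta,\varepsilon,h}:V\to[0,\infty]$ be \[ E_{\delta,\varepsilon,h}[y,b]=\int_0^L\overline Q_\delta(|y''|,|b'|)\,dx+\frac1{2\varepsilon_1}\int_0^L(y'\cdot b)^2\,dx+\frac1{2\varepsilon_2}\int_0^L(y'\cdot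 b')^2\,dx \] if $(y,b)\in\mathcal{S}^{3,1}(\mathcal{T})^3\times\mathcal{S}^{1,0}(\mathcal{T})^3$, $|y'(x_j)|^2=|b(x_j)|^2=1$ for $j=0,\dots,N$, and $L_{\rm bc}[y,b]=\ell_{\rm bc}$; and $E_{\delta,\varepsilon,h}[y,b]=+\infty$ otherwise. **Claim.** Let $\varepsilon_2>0$ be fixed. Then $E_{\delta,\varepsilon,h}$ $\Gamma$-converges to $E_{0,\varepsilon_2}$ as $(\delta,\varepsilon_1,h)\to0$ provided that $h^2\varepsilon_1^{-1}\to0$. That is, let $\mathcal{T}_n$ be partitionings with maximal mesh-sizes $h_n\to0$ that are uniformly quasiuniform (all elements of $\mathcal{T}_n$ have length at least $c\,h_n$ with $c>0$ independent of $n$), and let $\delta_n\ge0$, $\varepsilon_{1,n}>0$ with $\delta_n\to0$, $\varepsilon_{1,n}\to0$ and $h_n^2/\varepsilon_{1,n}\to0$. Write $E_n=E_{\delta_n,(\varepsilon_{1,n},\varepsilon_2),h_n}$ for the functional on $\mathcal{T}_n$. Then: (a) for every $(y,b)\in V$ and all $(y_n,b_n)\in V$ converging weakly in $V$ to $(y,b)$,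 $E_{0,\varepsilon_2}[y,b]\le\liminf_{n\to\infty}E_n[y_n,b_n]$; (b) for every $(y,b)\in V$ there are $(y_n,b_n)\in V$ converging strongly in $V$ to $(y,b)$ with $E_n[y_n,b_n]\to E_{0,\varepsilon_2}[y,b]$. No density or regularity assumption on the frames is made. -/

import Mathlib

open MeasureTheory Set Filter Topology
open scoped ContDiff

noncomputable section

namespace Ribbon

/-- Euclidean three-space. -/
abbrev E3 : Type := EuclideanSpace ℝ (Fin 3)

/-- Lebesgue measure on the open interval `(0, L)`. -/
abbrev intervalMeasure (L : ℝ) : Measure ℝ := volume.restrict (Ioo 0 L)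

/-! ### Sobolev spaces on `(0, L)` with values in three-space -/

/-- `w` is the weak derivative of `u` in `(0, L)`, tested against `C_c^∞(0, L)`. -/
def HasWeakDeriv (L : ℝ) (u w : ℝ → E3) : Prop :=
  ∀ φ : ℝ → ℝ, ContDiff ℝ ∞ φ → HasCompactSupport φ → tsupport φ ⊆ Ioo 0 L →
    ∫ x in Ioo 0 L, deriv φ x • u x = - ∫ x in Ioo 0 L, φ x • w x

lemma integrable_smul_Lp {L : ℝ} (u : Lp E3 2 (intervalMeasure L)) {φ : ℝ → ℝ}
    (hφ : Continuous φ) (hc : HasCompactSupport φ) :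
    Integrable (fun x => φ x • u x) (intervalMeasure L) := by
  obtain ⟨C, hC⟩ := hc.exists_bound_of_continuous hφ
  exact ((Lp.memLp u).integrable (by norm_num)).bdd_smul C
    hφ.aestronglyMeasurable (Eventually.of_forall hC)

/-- The Sobolev space `H^k(0, L; ℝ³)`. An element is stored together with its weak derivatives, as
the tuple `(u, u', …, u^(k))` of `L²` classes; it is determined by `u`, and the norm is
`(‖u‖² + ‖u'‖² + … + ‖u^(k)‖²)^(1/2)`. -/
def Sobolev (k : ℕ) (L : ℝ) :
    Submodule ℝ (PiLp 2 fun _ : Fin (k + 1) => Lp E3 2 (intervalMeasure L)) where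
  carrier := {u | ∀ j : Fin k, HasWeakDeriv L (u j.castSucc) (u j.succ)}
  zero_mem' := by
    intro j φ _ _ _
    have h0 : ((0 : Lp E3 2 (intervalMeasure L)) : ℝ → E3) =ᵐ[intervalMeasure L] 0 :=
      Lp.coeFn_zero _ _ _
    have h1 : ∀ ψ : ℝ → ℝ, ∫ x in Ioo 0 L,
        ψ x • ((0 : Lp E3 2 (intervalMeasure L)) : ℝ → E3) x = 0 := fun ψ =>
      integral_eq_zero_of_ae (by filter_upwards [h0] with x hx; rw [hx]; simp)
    simp only [PiLp.zero_apply, h1, neg_zero]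
  add_mem' := by
    intro u v hu hv j φ h1 h2 h3
    have key : ∀ (ψ : ℝ → ℝ), Continuous ψ → HasCompactSupport ψ →
        ∀ a b : Lp E3 2 (intervalMeasure L),
        ∫ x in Ioo 0 L, ψ x • (a + b : Lp E3 2 (intervalMeasure L)) x
          = (∫ x in Ioo 0 L, ψ x • a x) + ∫ x in Ioo 0 L, ψ x • b x := by
      intro ψ hψ hψc a b
      rw [← integral_add (integrable_smul_Lp a hψ hψc) (integrable_smul_Lp b hψ hψc)]
      refine integral_congr_ae ?_
      filter_upwards [Lp.coeFn_add a b] with x hx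
      rw [hx, Pi.add_apply, smul_add]
    have e1 := hu j φ h1 h2 h3
    have e2 := hv j φ h1 h2 h3
    simp only [PiLp.add_apply]
    rw [key _ (h1.continuous_deriv (by simp)) h2.deriv, key _ h1.continuous h2, e1, e2, neg_add]
  smul_mem' := by
    intro c u hu j φ h1 h2 h3
    have key : ∀ (ψ : ℝ → ℝ) (a : Lp E3 2 (intervalMeasure L)),
        ∫ x in Ioo 0 L, ψ x • (c • a : Lp E3 2 (intervalMeasure L)) x
          = c • ∫ x in Ioo 0 L, ψ x • a x := by
      intro ψ a
      rw [← integral_smul]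
      refine integral_congr_ae ?_
      filter_upwards [Lp.coeFn_smul c a] with x hx
      rw [hx, Pi.smul_apply, smul_comm]
    have e1 := hu j φ h1 h2 h3
    simp only [PiLp.smul_apply]
    rw [key, key, e1, smul_neg]

/-- The space `V = H²(0, L; ℝ³) × H¹(0, L; ℝ³)` of pairs `(y, b)`. -/
abbrev PairSpace (L : ℝ) : Type := Sobolev 2 L × Sobolev 1 L

section Components

variable {L : ℝ}

/-- `y` -/
def yFun (v : PairSpace L) : ℝ → E3 := v.1.1 0

/-- `y'` -/
def yDeriv (v : PairSpace L) : ℝ → E3 := v.1.1 1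

/-- `y''` -/
def yDeriv2 (v : PairSpace L) : ℝ → E3 := v.1.1 2

/-- `b` -/
def bFun (v : PairSpace L) : ℝ → E3 := v.2.1 0

/-- `b'` -/
def bDeriv (v : PairSpace L) : ℝ → E3 := v.2.1 1

end Components

open Classical in
/-- The continuous representative on `[0, L]` of a function given almost everywhere in `(0, L)`.
It exists for every `H¹` function and is unique on `[0, L]`; it is used only for `y`, `y'` and `b`
with `(y, b) ∈ V`, and only at points of `[0, L]`. -/
def contRep (L : ℝ) (u : ℝ → E3) : ℝ → E3 :=
  if h : ∃ g : ℝ → E3, ContinuousOn g (Icc 0 L) ∧ u =ᵐ[intervalMeasure L] g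
  then h.choose else 0

/-- The boundary values `y(0), y(L), y'(0), y'(L), b(0), b(L)`. -/
def boundaryValues {L : ℝ} (v : PairSpace L) : Fin 6 → E3 :=
  ![contRep L (yFun v) 0, contRep L (yFun v) L,
    contRep L (yDeriv v) 0, contRep L (yDeriv v) L,
    contRep L (bFun v) 0, contRep L (bFun v) L]

/-! ### Energy densities -/

/-- The density `Q̄` of the corrected Sadowsky functional. -/
def Qbar (α β : ℝ) : ℝ :=
  if |β| ≤ |α| then (α ^ 2 + β ^ 2) ^ 2 / α ^ 2 else 4 * β ^ 2

/-- `m δ x = |x|_δ` is a regularized modulus: nonnegative, for `δ > 0` of class `C²` with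
`|·|_δ ≥ c₀ δ`, `|·|_δ' ≤ c₁`, `|·|_δ'' ≤ c₂ / δ`, and `||x|_δ - |x|| ≤ c_uni δ` for `δ ≥ 0`
(so that `|·|_0 = |·|`). -/
structure IsRegularizedModulus (m : ℝ → ℝ → ℝ) (c₀ c₁ c₂ cuni : ℝ) : Prop where
  c₀_pos : 0 < c₀
  nonneg : ∀ δ, 0 ≤ δ → ∀ x, 0 ≤ m δ x
  contDiff : ∀ δ, 0 < δ → ContDiff ℝ 2 (m δ)
  lower : ∀ δ, 0 < δ → ∀ x, c₀ * δ ≤ m δ x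
  deriv_le : ∀ δ, 0 < δ → ∀ x, deriv (m δ) x ≤ c₁
  deriv2_le : ∀ δ, 0 < δ → ∀ x, deriv (deriv (m δ)) x ≤ c₂ * δ⁻¹
  uniform : ∀ δ, 0 ≤ δ → ∀ x, |m δ x - abs x| ≤ cuni * δ

/-- The regularized density `Q̄_δ`, with `|x|_δ = m δ x`. -/
def Qreg (m : ℝ → ℝ → ℝ) (δ α β : ℝ) : ℝ :=
  2 * β ^ 2 + α ^ 2 / 2 + β ^ 2 / 2 + m δ (α ^ 2 - β ^ 2) / 2
    + 2 * β ^ 4 / (α ^ 2 + β ^ 2 + m δ (α ^ 2 - β ^ 2))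

/-- `Q̄_δ` coincides with `Q̄` for `δ = 0`. -/
lemma Qreg_zero {m : ℝ → ℝ → ℝ} {c₀ c₁ c₂ cuni : ℝ}
    (hm : IsRegularizedModulus m c₀ c₁ c₂ cuni) (α β : ℝ) : Qreg m 0 α β = Qbar α β := by
  have h0 : ∀ x, m 0 x = |x| := fun x => by
    have := hm.uniform 0 le_rfl x
    rw [mul_zero] at this
    exact sub_eq_zero.mp (abs_nonpos_iff.mp this)
  unfold Qreg Qbar
  rw [h0]
  split_ifs with h
  · have h2 : β ^ 2 ≤ α ^ 2 := sq_le_sq.mpr h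
    rw [abs_of_nonneg (sub_nonneg.mpr h2)]
    rcases eq_or_ne α 0 with rfl | hα
    · have : β = 0 := by simpa using h
      subst this; simp
    · have : α ^ 2 + β ^ 2 + (α ^ 2 - β ^ 2) = 2 * α ^ 2 := by ring
      rw [this]; field_simp; ring
  · push Not at h
    have h2 : α ^ 2 < β ^ 2 := sq_lt_sq.mpr h
    have hβ : β ≠ 0 := by
      rintro rfl
      simp only [ne_eq, OfNat.ofNat_ne_zero, not_false_eq_true, zero_pow] at h2
      exact absurd h2 (not_lt.mpr (sq_nonneg α))
    rw [abs_of_neg (sub_neg.mpr h2)]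
    have : α ^ 2 + β ^ 2 + -(α ^ 2 - β ^ 2) = 2 * β ^ 2 := by ring
    rw [this]; field_simp; ring

/-! ### The continuous functional -/

/-- The matrix with columns `a`, `b`, `a × b`. -/
def frameMatrix (a b : E3) : Matrix (Fin 3) (Fin 3) ℝ :=
  (Matrix.of ![a.ofLp, b.ofLp, crossProduct a.ofLp b.ofLp]).transpose

/-- The set of admissible frames. -/
def admissibleFrames {F : Type*} [NormedAddCommGroup F] [NormedSpace ℝ F] (L : ℝ)
    (Lbc : PairSpace L →L[ℝ] F) (lbc : F) : Set (PairSpace L) :=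
  {v | (∀ᵐ x ∂(intervalMeasure L),
      frameMatrix (yDeriv v x) (bFun v x) ∈ Matrix.specialOrthogonalGroup (Fin 3) ℝ) ∧
    Lbc v = lbc}

open Classical in
/-- The constrained functional `E_{0,ε₂}`: the corrected Sadowsky energy with penalty for
`y' · b' = 0` on admissible frames, and `+∞` elsewhere. The integrands are integrable for every
`(y, b) ∈ V`. -/
def penalizedEnergy {F : Type*} [NormedAddCommGroup F] [NormedSpace ℝ F] (L : ℝ)
    (Lbc : PairSpace L →L[ℝ] F) (lbc : F) (ε₂ : ℝ) (v : PairSpace L) : EReal :=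
  if v ∈ admissibleFrames L Lbc lbc then
    (((∫ x in Ioo 0 L, Qbar ‖yDeriv2 v x‖ ‖bDeriv v x‖)
      + 1 / (2 * ε₂) * ∫ x in Ioo 0 L, (inner ℝ (yDeriv v x) (bDeriv v x)) ^ 2 : ℝ) : EReal)
  else ⊤

/-! ### Finite element spaces and the discrete functional -/

/-- A partitioning `0 = x_0 < x_1 < … < x_N = L`. -/
structure Partition (L : ℝ) where
  N : ℕ
  node : Fin (N + 1) → ℝ
  strictMono : StrictMono node
  node_zero : node 0 = 0
  node_last : node (Fin.last N) = L

/-- The length of an element. -/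
def Partition.elemSize {L : ℝ} (T : Partition L) (j : Fin T.N) : ℝ :=
  T.node j.succ - T.node j.castSucc

/-- The maximal mesh-size `h` (a maximum over a finite set, nonempty if `L > 0`). -/
def Partition.meshSize {L : ℝ} (T : Partition L) : ℝ := ⨆ j : Fin T.N, T.elemSize j

/-- The finite element space `S^{p,k}(T)` of functions in `C^k(0, L)` that are polynomials of degree
at most `p` on every closed element (the values outside `[0, L]` are irrelevant). -/
def splineSpace {L : ℝ} (T : Partition L) (p k : ℕ) : Set (ℝ → ℝ) :=
  {f | ContDiffOn ℝ k f (Ioo 0 L) ∧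
    ∀ j : Fin T.N, ∃ q : Polynomial ℝ, q.natDegree ≤ p ∧
      ∀ x ∈ Icc (T.node j.castSucc) (T.node j.succ), f x = q.eval x}

/-- `V_h = S^{3,1}(T)³ × S^{1,0}(T)³`, as a subset of `V`. -/
def discreteSpace {L : ℝ} (T : Partition L) : Set (PairSpace L) :=
  {v | (∃ f : ℝ → E3, (∀ i, (fun x => f x i) ∈ splineSpace T 3 1) ∧
        yFun v =ᵐ[intervalMeasure L] f) ∧
    (∃ g : ℝ → E3, (∀ i, (fun x => g x i) ∈ splineSpace T 1 0) ∧
        bFun v =ᵐ[intervalMeasure L] g)}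

/-- The discrete admissible pairs: elements of `V_h` with `|y_h'|² = |b_h|² = 1` at all nodes and
`L_bc[y_h, b_h] = ℓ_bc`. -/
def discreteAdmissible {F : Type*} [NormedAddCommGroup F] [NormedSpace ℝ F] {L : ℝ}
    (T : Partition L) (Lbc : PairSpace L →L[ℝ] F) (lbc : F) : Set (PairSpace L) :=
  {v | v ∈ discreteSpace T ∧
    (∀ j, ‖contRep L (yDeriv v) (T.node j)‖ ^ 2 = 1 ∧ ‖contRep L (bFun v) (T.node j)‖ ^ 2 = 1) ∧
    Lbc v = lbc}

open Classical in
/-- The constrained functional `E_{δ,ε,h}`, `ε = (ε₁, ε₂)`, equal to `+∞` off the discrete admissible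
pairs. The integrands are integrable for every `(y, b) ∈ V`. -/
def discreteEnergy {F : Type*} [NormedAddCommGroup F] [NormedSpace ℝ F] {L : ℝ}
    (m : ℝ → ℝ → ℝ) (Lbc : PairSpace L →L[ℝ] F) (lbc : F) (δ ε₁ ε₂ : ℝ) (T : Partition L)
    (v : PairSpace L) : EReal :=
  if v ∈ discreteAdmissible T Lbc lbc then
    (((∫ x in Ioo 0 L, Qreg m δ ‖yDeriv2 v x‖ ‖bDeriv v x‖)
      + 1 / (2 * ε₁) * (∫ x in Ioo 0 L, (inner ℝ (yDeriv v x) (bFun v x)) ^ 2)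
      + 1 / (2 * ε₂) * ∫ x in Ioo 0 L, (inner ℝ (yDeriv v x) (bDeriv v x)) ^ 2 : ℝ) : EReal)
  else ⊤

/-! ### Γ-convergence -/

/-- Γ-convergence of `G n` to `G₀` on a normed space: the lower bound holds along weakly convergent
sequences, recovery sequences converge strongly. (This gives sequential Γ-convergence with respect
to both the weak and the norm topology.) -/
structure GammaConverges {X : Type*} [NormedAddCommGroup X] [NormedSpace ℝ X]
    (G : ℕ → X → EReal) (G₀ : X → EReal) : Prop where
  liminf_ge : ∀ (u : ℕ → X) (v : X),
    (∀ l : X →L[ℝ] ℝ, Tendsto (fun n => l (u n)) atTop (𝓝 (l v))) →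
    G₀ v ≤ liminf (fun n => G n (u n)) atTop
  recovery : ∀ v : X, ∃ u : ℕ → X, Tendsto u atTop (𝓝 v) ∧
    Tendsto (fun n => G n (u n)) atTop (𝓝 (G₀ v))

end Ribbon

end

/-!
# Γ-convergence of the discretized, regularized Sadowsky functional

An element of `H¹(0, L)` is a constant plus the primitive of its weak derivative (du
Bois-Reymond), so a pair `(y, b)` is determined by its initial values and by `(y'', b') ∈ L² ×
L²`, and point values of `y`, `y'` and `b` are bounded linear functionals on `V`
(`HasWeakDeriv.ae_eq_evalAt`). By the Hölder estimate for primitives, weak convergence in `V`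
implies uniform convergence of `y'` and `b` (`tendstoUniformlyOn_evalAt`).

*Lower bound.* The density satisfies `Q̄(α, β) = min_{s ≥ |α|} (2β² + s² + β⁴/s²)`, a partial
minimum of a jointly convex function, so `(y'', b') ↦ Q̄(|y''|, |b'|)` is convex
(`Qbar_norm_convex`), and `|Q̄_δ - Q̄| ≤ 3 c_uni δ` (`abs_Qreg_sub_Qbar_le`). In the penalty for
`y' · b'` the tangent may be replaced by its uniform limit, at a cost that tends to zero. What
remains is convex and strongly continuous in `(y'', b')`, hence weakly lower semicontinuous
(`tendsto_bulkEnergy_sub_frozenEnergy`, `convexOn_frozenEnergy`). The unit length at the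
increasingly dense nodes and the penalty with weight `1/ε₁` make the limit an orthonormal frame
(`penalizedEnergy_le_of_discreteEnergy_le`).

*Recovery.* For an admissible pair, let `y''` be replaced by its `L²` projection onto piecewise
affine functions and `b'` by its projection onto piecewise constants, with the initial values
kept. The preserved moments say that nodal values of `y`, `y'` and `b` do not change, so this is
cubic Hermite interpolation of `y` and affine interpolation of `b`
(`primitive_primitive_starProjection_sub_node`); the nodal constraints and the boundary conditions
hold exactly, and no regularity or density of frames is needed. The projections converge strongly
since piecewise constants approximate continuous functions. Finally `y' · b` vanishes at the
nodes, so its square integral is `O(h²)` (`integral_inner_sq_le_of_nodes`) and the penalty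
vanishes as `h²/ε₁ → 0`. Where the limit energy is infinite the lower bound already makes the
constant sequence a recovery sequence.
-/

noncomputable section

namespace Ribbon

/-! ### Weak derivatives and primitives -/

/-- An integrable function on `(0, L)` all of whose integrals against derivatives of test functions
vanish is constant (du Bois-Reymond). -/
lemma exists_ae_eq_const_of_integral_deriv_eq_zero {L : ℝ} (hL : 0 < L) {u : ℝ → E3}
    (hu : IntegrableOn u (Ioo 0 L))
    (h : ∀ φ : ℝ → ℝ, ContDiff ℝ ∞ φ → HasCompactSupport φ → tsupport φ ⊆ Ioo 0 L →
      ∫ x in Ioo 0 L, deriv φ x • u x = 0) :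
    ∃ c : E3, u =ᵐ[intervalMeasure L] fun _ => c := by
  have hbound : ∀ φ : ℝ → ℝ, Continuous φ → HasCompactSupport φ →
      IntegrableOn (fun x => φ x • u x) (Ioo 0 L) := fun φ hφ hc => by
    obtain ⟨C, hC⟩ := hc.exists_bound_of_continuous hφ
    exact hu.bdd_smul C hφ.aestronglyMeasurable (Eventually.of_forall hC)
  -- a test function of integral one
  let B : ContDiffBump (L / 2) := ⟨L / 8, L / 4, by positivity, by linarith⟩
  set ψ : ℝ → ℝ := B.normed volume with hψ
  have hψs : ContDiff ℝ ∞ ψ := B.contDiff_normed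
  have hψc : HasCompactSupport ψ := B.hasCompactSupport_normed
  have hψi : ∫ x, ψ x = 1 := B.integral_normed
  have hψt : tsupport ψ ⊆ Ioo 0 L := by
    rw [hψ, B.tsupport_normed_eq, Real.closedBall_eq_Icc]
    intro x hx
    simp only [B, mem_Icc, mem_Ioo] at hx ⊢
    constructor <;> linarith [hx.1, hx.2]
  refine ⟨∫ x in Ioo 0 L, ψ x • u x, ?_⟩
  set c := ∫ x in Ioo 0 L, ψ x • u x with hc
  have key : ∀ φ : ℝ → ℝ, ContDiff ℝ ∞ φ → HasCompactSupport φ → tsupport φ ⊆ Ioo 0 L →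
      ∫ x in Ioo 0 L, φ x • u x = (∫ x, φ x) • c := by
    intro φ hφ hφc hφt
    set s := ∫ x, φ x with hs
    -- subtracting a multiple of `ψ` gives mean value zero, hence a compactly supported primitive
    set χ : ℝ → ℝ := fun x => φ x - s * ψ x with hχ
    have hχs : ContDiff ℝ ∞ χ := hφ.sub (contDiff_const.mul hψs)
    have hK : IsCompact (tsupport φ ∪ tsupport ψ) := hφc.isCompact.union hψc.isCompact
    have hKne : (tsupport φ ∪ tsupport ψ).Nonempty := by
      by_contra hne
      have h0 : ψ = 0 := by
        rw [← tsupport_eq_empty_iff]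
        exact (union_empty_iff.1 (not_nonempty_iff_eq_empty.1 hne)).2
      rw [h0] at hψi
      simp at hψi
    obtain ⟨a, haK, ha⟩ := hK.exists_isLeast hKne
    obtain ⟨b, hbK, hb⟩ := hK.exists_isGreatest hKne
    have hKs : tsupport φ ∪ tsupport ψ ⊆ Ioo 0 L := union_subset hφt hψt
    have ha0 := hKs haK
    have hb0 := hKs hbK
    have hχ0 : ∀ x, x ∉ Icc a b → χ x = 0 := by
      intro x hx
      have hxK : x ∉ tsupport φ ∪ tsupport ψ := fun hxK => hx ⟨ha hxK, hb hxK⟩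
      have h1 : φ x = 0 := image_eq_zero_of_notMem_tsupport fun h => hxK (Or.inl h)
      have h2 : ψ x = 0 := image_eq_zero_of_notMem_tsupport fun h => hxK (Or.inr h)
      simp [hχ, h1, h2]
    have hχi : ∫ x, χ x = 0 := by
      rw [hχ, integral_sub, integral_const_mul, hψi, mul_one, sub_self]
      · exact hφ.continuous.integrable_of_hasCompactSupport hφc
      · exact (hψs.continuous.integrable_of_hasCompactSupport hψc).const_mul s
    set η : ℝ → ℝ := fun x => ∫ t in a..x, χ t with hη
    have hηd : ∀ x, HasDerivAt η (χ x) x := fun x =>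
      hχs.continuous.integral_hasStrictDerivAt a x |>.hasDerivAt
    have hηd' : deriv η = χ := funext fun x => (hηd x).deriv
    have hηs : ContDiff ℝ ∞ η := by
      rw [contDiff_infty_iff_deriv, hηd']
      exact ⟨fun x => (hηd x).differentiableAt, hχs⟩
    have hη0 : ∀ x, x ∉ Icc a b → η x = 0 := by
      intro x hx
      rcases lt_or_ge x a with hxa | hxa
      · simp only [hη]
        rw [intervalIntegral.integral_symm, intervalIntegral.integral_of_le hxa.le,
          neg_eq_zero, integral_Ioc_eq_integral_Ioo]
        exact setIntegral_eq_zero_of_forall_eq_zero fun t ht => hχ0 t fun h => by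
          linarith [h.1, ht.2]
      · have hxb : b < x := by
          by_contra hxb
          exact hx ⟨hxa, not_lt.1 hxb⟩
        simp only [hη]
        rw [intervalIntegral.integral_of_le hxa, ← integral_Icc_eq_integral_Ioc,
          setIntegral_eq_integral_of_forall_compl_eq_zero, hχi]
        intro t ht
        exact hχ0 t fun h => ht ⟨h.1, h.2.trans hxb.le⟩
    have hηt : tsupport η ⊆ Icc a b :=
      closure_minimal (fun x hx => by_contra fun hn => hx (hη0 x hn)) isClosed_Icc
    have hηc : HasCompactSupport η := HasCompactSupport.intro isCompact_Icc hη0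
    have h0 := h η hηs hηc (hηt.trans fun x hx => ⟨ha0.1.trans_le hx.1, hx.2.trans_lt hb0.2⟩)
    rw [hηd'] at h0
    simp only [hχ, sub_smul, mul_smul] at h0
    have h1 := integral_sub (hbound φ hφ.continuous hφc)
      ((hbound ψ hψs.continuous hψc).smul s)
    simp only [Pi.smul_apply] at h1
    rw [h1, integral_smul, sub_eq_zero] at h0
    exact h0
  have hloc : LocallyIntegrableOn (fun x => u x - c) (Ioo 0 L) :=
    (hu.sub (integrable_const c)).locallyIntegrableOn
  have := isOpen_Ioo.ae_eq_zero_of_integral_contDiff_smul_eq_zero (μ := volume) hloc (by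
    intro φ hφ hφc hφt
    have h1 : ∫ x, φ x • (u x - c) = ∫ x in Ioo 0 L, φ x • (u x - c) := by
      refine (setIntegral_eq_integral_of_forall_compl_eq_zero fun x hx => ?_).symm
      rw [image_eq_zero_of_notMem_tsupport fun h => hx (hφt h), zero_smul]
    have h2 : ∫ x in Ioo 0 L, φ x = ∫ x, φ x :=
      setIntegral_eq_integral_of_forall_compl_eq_zero fun x hx =>
        image_eq_zero_of_notMem_tsupport fun h => hx (hφt h)
    simp only [smul_sub] at h1 ⊢
    rw [h1, integral_sub (hbound φ hφ.continuous hφc)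
      ((hφ.continuous.integrable_of_hasCompactSupport hφc).integrableOn.smul_const c),
      key φ hφ hφc hφt, integral_smul_const, h2, sub_self])
  rw [EventuallyEq, ae_restrict_iff' measurableSet_Ioo]
  filter_upwards [this] with x hx hx'
  exact sub_eq_zero.1 (hx hx')

/-- The primitive `x ↦ ∫₀ˣ w` of `w` on `(0, L)`; the values of `w` off `(0, L)` are ignored, so
that the primitive of an integrable function is continuous on the whole line. -/
def primitive (L : ℝ) (w : ℝ → E3) (x : ℝ) : E3 := ∫ t in (0 : ℝ)..x, (Ioo 0 L).indicator w t

lemma primitive_zero (L : ℝ) (w : ℝ → E3) : primitive L w 0 = 0 := by simp [primitive]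

lemma primitive_congr {L : ℝ} {v w : ℝ → E3} (h : v =ᵐ[intervalMeasure L] w) :
    primitive L v = primitive L w := by
  have : (Ioo 0 L).indicator v =ᵐ[volume] (Ioo 0 L).indicator w :=
    (ae_eq_restrict_iff_indicator_ae_eq measurableSet_Ioo).1 h
  funext x
  exact intervalIntegral.integral_congr_ae (this.mono fun t ht _ => ht)

lemma integrable_indicator_of_integrableOn {L : ℝ} {w : ℝ → E3} (hw : IntegrableOn w (Ioo 0 L)) :
    Integrable ((Ioo 0 L).indicator w) := (integrable_indicator_iff measurableSet_Ioo).2 hw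

lemma continuous_primitive {L : ℝ} {w : ℝ → E3} (hw : IntegrableOn w (Ioo 0 L)) :
    Continuous (primitive L w) :=
  intervalIntegral.continuous_primitive
    (fun _ _ => (integrable_indicator_of_integrableOn hw).intervalIntegrable) 0

lemma primitive_sub_primitive {L : ℝ} {w : ℝ → E3} (hw : IntegrableOn w (Ioo 0 L)) (x y : ℝ) :
    primitive L w y - primitive L w x = ∫ t in x..y, (Ioo 0 L).indicator w t :=
  intervalIntegral.integral_interval_sub_left
    (integrable_indicator_of_integrableOn hw).intervalIntegrable
    (integrable_indicator_of_integrableOn hw).intervalIntegrable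

/-- A primitive is weakly differentiable. Componentwise this is integration by parts for absolutely
continuous functions. -/
lemma hasWeakDeriv_const_add_primitive {L : ℝ} (hL : 0 < L) {w : ℝ → E3}
    (hw : IntegrableOn w (Ioo 0 L)) (C : E3) :
    HasWeakDeriv L (fun x => C + primitive L w x) w := by
  intro φ hφ hφc hφt
  set g := (Ioo 0 L).indicator w with hg
  have hgi : Integrable g := integrable_indicator_of_integrableOn hw
  have hφ0 : ∀ x, x ∉ Ioo 0 L → φ x = 0 := fun x hx =>
    image_eq_zero_of_notMem_tsupport fun h => hx (hφt h)
  have hdc : Continuous (deriv φ) := hφ.continuous_deriv (by simp)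
  have hφi : IntegrableOn (fun x => φ x • w x) (Ioo 0 L) := by
    obtain ⟨M, hM⟩ := hφc.exists_bound_of_continuous hφ.continuous
    exact hw.bdd_smul M hφ.continuous.aestronglyMeasurable (Eventually.of_forall hM)
  have hdi : IntegrableOn (fun x => deriv φ x • (C + primitive L w x)) (Ioo 0 L) :=
    ((hdc.smul (continuous_const.add (continuous_primitive hw))).integrableOn_Icc).mono_set
      Ioo_subset_Icc_self
  ext i
  have ev : ∀ {f : ℝ → E3}, IntegrableOn f (Ioo 0 L) →
      (∫ x in Ioo 0 L, f x) i = ∫ x in (0 : ℝ)..L, f x i := by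
    intro f hf
    rw [intervalIntegral.integral_of_le hL.le, integral_Ioc_eq_integral_Ioo]
    exact ((EuclideanSpace.proj i : E3 →L[ℝ] ℝ).integral_comp_comm hf).symm
  have hgi' : Integrable (fun x => g x i) :=
    (EuclideanSpace.proj i : E3 →L[ℝ] ℝ).integrable_comp hgi
  have hcomp : ∀ x, (C + primitive L w x) i = C i + ∫ t in (0 : ℝ)..x, g t i := by
    intro x
    have := (EuclideanSpace.proj i : E3 →L[ℝ] ℝ).intervalIntegral_comp_comm
      (hgi.intervalIntegrable (a := 0) (b := x))
    simp only [PiLp.add_apply, add_right_inj]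
    exact this.symm
  have hac := (hgi'.intervalIntegrable (a := 0) (b := L)
    ).absolutelyContinuousOnInterval_intervalIntegral (c := 0) (by simp)
  have hac' : AbsolutelyContinuousOnInterval (fun x => C i + ∫ t in (0 : ℝ)..x, g t i) 0 L := by
    have h1 : AbsolutelyContinuousOnInterval (fun _ : ℝ => C i) 0 L :=
      (LipschitzWith.const (C i)).lipschitzOnWith.absolutelyContinuousOnInterval
    exact h1.fun_add hac
  have hφac : AbsolutelyContinuousOnInterval φ 0 L := by
    have h1 := (hdc.intervalIntegrable (μ := volume) 0 L
      ).absolutelyContinuousOnInterval_intervalIntegral (c := 0) (by simp)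
    have h2 : (fun x => ∫ t in (0 : ℝ)..x, deriv φ t) = φ := by
      funext x
      rw [intervalIntegral.integral_deriv_eq_sub
        (fun t _ => (hφ.differentiable (by simp)).differentiableAt) (hdc.intervalIntegrable _ _),
        hφ0 0 (by simp), sub_zero]
    rwa [h2] at h1
  have hparts := hφac.integral_mul_deriv_eq_deriv_mul hac'
  rw [hφ0 0 (by simp), hφ0 L (by simp)] at hparts
  rw [PiLp.neg_apply, ev hdi, ev hφi]
  have e1 : ∫ x in (0 : ℝ)..L, φ x * deriv (fun x => C i + ∫ t in (0 : ℝ)..x, g t i) x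
      = ∫ x in (0 : ℝ)..L, (φ x • w x) i := by
    refine intervalIntegral.integral_congr_ae ?_
    filter_upwards [LocallyIntegrable.ae_hasDerivAt_integral hgi'.locallyIntegrable,
      Ioo_ae_eq_Ioc (α := ℝ) (μ := volume) (a := 0) (b := L)] with x hx hxm hx0
    rw [uIoc_of_le hL.le] at hx0
    have hxI : x ∈ Ioo 0 L := by
      have : (Ioo 0 L x : Prop) = (Ioc 0 L x : Prop) := hxm
      exact this.mpr hx0
    rw [((hx 0).const_add (C i)).deriv]
    simp [hg, indicator_of_mem hxI]
  rw [← e1, hparts]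
  simp only [PiLp.smul_apply, hcomp, smul_eq_mul]
  ring

lemma HasWeakDeriv.congr_left {L : ℝ} {u v w : ℝ → E3} (h : HasWeakDeriv L u w)
    (huv : u =ᵐ[intervalMeasure L] v) : HasWeakDeriv L v w := by
  intro φ h1 h2 h3
  rw [← h φ h1 h2 h3]
  exact integral_congr_ae (huv.mono fun x hx => by simp only [hx])

/-- A function with an integrable weak derivative is, up to a constant, the primitive of it. -/
lemma HasWeakDeriv.exists_ae_eq {L : ℝ} (hL : 0 < L) {u w : ℝ → E3} (h : HasWeakDeriv L u w)
    (hu : IntegrableOn u (Ioo 0 L)) (hw : IntegrableOn w (Ioo 0 L)) :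
    ∃ C : E3, u =ᵐ[intervalMeasure L] fun x => C + primitive L w x := by
  have hp : IntegrableOn (primitive L w) (Ioo 0 L) :=
    (continuous_primitive hw).integrableOn_Icc.mono_set Ioo_subset_Icc_self
  obtain ⟨C, hC⟩ := exists_ae_eq_const_of_integral_deriv_eq_zero hL
    (u := fun x => u x - primitive L w x) (hu.sub hp) (by
      intro φ h1 h2 h3
      have hdc : Continuous (deriv φ) := h1.continuous_deriv (by simp)
      obtain ⟨M, hM⟩ := h2.deriv.exists_bound_of_continuous hdc
      have hb : ∀ {f : ℝ → E3}, IntegrableOn f (Ioo 0 L) →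
          IntegrableOn (fun x => deriv φ x • f x) (Ioo 0 L) := fun hf =>
        Integrable.bdd_smul hf M hdc.aestronglyMeasurable (Eventually.of_forall hM)
      have h4 := hasWeakDeriv_const_add_primitive hL hw 0 φ h1 h2 h3
      simp only [zero_add] at h4
      simp only [smul_sub]
      rw [integral_sub (hb hu) (hb hp), h φ h1 h2 h3, h4, sub_self])
  exact ⟨C, hC.mono fun x hx => by simp only at hx ⊢; rw [← hx]; abel⟩

/-! ### Primitives on `L²` and point evaluation on `H¹` -/

/-- The space `L²(0, L; ℝ³)`. -/
abbrev L2Space (L : ℝ) : Type := Lp E3 2 (intervalMeasure L)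

namespace L2Space

variable {L : ℝ}

lemma integrableOn (w : L2Space L) : IntegrableOn w (Ioo 0 L) :=
  (Lp.memLp w).integrable (by norm_num)

lemma integrableOn_norm_sq (w : L2Space L) : IntegrableOn (fun x => ‖w x‖ ^ 2) (Ioo 0 L) :=
  (Lp.memLp w).integrable_norm_pow (by norm_num)

lemma norm_sq_eq (w : L2Space L) : ‖w‖ ^ 2 = ∫ x in Ioo 0 L, ‖w x‖ ^ 2 := by
  rw [← real_inner_self_eq_norm_sq, L2.inner_def]
  simp only [real_inner_self_eq_norm_sq]

end L2Space

/-- The Cauchy–Schwarz inequality against the constant function one. -/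
lemma sq_intervalIntegral_le {f : ℝ → ℝ} {a b : ℝ} (hab : a ≤ b)
    (hf : IntervalIntegrable f volume a b)
    (hf2 : IntervalIntegrable (fun x => f x ^ 2) volume a b) :
    (∫ x in a..b, f x) ^ 2 ≤ (b - a) * ∫ x in a..b, f x ^ 2 := by
  rcases hab.eq_or_lt with rfl | hlt
  · simp
  set I := ∫ x in a..b, f x
  have hpos : 0 < b - a := sub_pos.2 hlt
  -- the variance of `f` is nonnegative
  have h0 : 0 ≤ ∫ x in a..b, ((b - a) * f x - I) ^ 2 :=
    intervalIntegral.integral_nonneg hab fun x _ => sq_nonneg _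
  have h1 : ∫ x in a..b, ((b - a) * f x - I) ^ 2
      = (b - a) * ((b - a) * (∫ x in a..b, f x ^ 2) - I ^ 2) := by
    have : ∀ x, ((b - a) * f x - I) ^ 2
        = (b - a) ^ 2 * f x ^ 2 - 2 * (b - a) * I * f x + I ^ 2 := fun x => by ring
    simp only [this]
    rw [intervalIntegral.integral_add ((hf2.const_mul _).sub (hf.const_mul _)) (by simp),
      intervalIntegral.integral_sub (hf2.const_mul _) (hf.const_mul _),
      intervalIntegral.integral_const_mul, intervalIntegral.integral_const_mul,
      intervalIntegral.integral_const, smul_eq_mul]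
    change _ - 2 * (b - a) * I * I + _ = _
    ring
  rw [h1] at h0
  linarith [nonneg_of_mul_nonneg_right h0 hpos]

section Primitive

variable {L : ℝ}

lemma norm_indicator_sq (w : ℝ → E3) :
    (fun x => ‖(Ioo 0 L).indicator w x‖ ^ 2) = (Ioo 0 L).indicator fun x => ‖w x‖ ^ 2 := by
  funext x
  by_cases hx : x ∈ Ioo 0 L <;> simp [hx]

lemma integrable_norm_indicator_sq (w : L2Space L) :
    Integrable fun x => ‖(Ioo 0 L).indicator w x‖ ^ 2 := by
  rw [norm_indicator_sq]
  exact (integrable_indicator_iff measurableSet_Ioo).2 w.integrableOn_norm_sq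

/-- The local Hölder estimate for primitives, `|∫ₓʸ w|² ≤ (y - x) ∫ₓʸ |w|²`. -/
lemma norm_primitive_sub_sq_le_integral (w : L2Space L) {x y : ℝ} (hxy : x ≤ y) :
    ‖primitive L w y - primitive L w x‖ ^ 2
      ≤ (y - x) * ∫ t in x..y, ‖(Ioo 0 L).indicator w t‖ ^ 2 := by
  rw [primitive_sub_primitive w.integrableOn]
  have hg := integrable_indicator_of_integrableOn w.integrableOn
  calc ‖∫ t in x..y, (Ioo 0 L).indicator w t‖ ^ 2
      ≤ (∫ t in x..y, ‖(Ioo 0 L).indicator w t‖) ^ 2 := by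
        gcongr
        exact intervalIntegral.norm_integral_le_integral_norm hxy
    _ ≤ _ := sq_intervalIntegral_le hxy hg.norm.intervalIntegrable
        (integrable_norm_indicator_sq w).intervalIntegrable

lemma norm_primitive_sub_sq_le (w : L2Space L) {x y : ℝ} (hxy : x ≤ y) :
    ‖primitive L w y - primitive L w x‖ ^ 2 ≤ (y - x) * ‖w‖ ^ 2 := by
  refine (norm_primitive_sub_sq_le_integral w hxy).trans ?_
  have : 0 ≤ y - x := sub_nonneg.2 hxy
  gcongr
  rw [w.norm_sq_eq, ← integral_indicator measurableSet_Ioo, ← norm_indicator_sq,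
    intervalIntegral.integral_of_le hxy]
  exact setIntegral_le_integral (integrable_norm_indicator_sq w)
    (Eventually.of_forall fun t => by positivity)

/-- Primitives of `L²` functions are Hölder continuous with exponent `1/2`. -/
lemma norm_primitive_sub_le (w : L2Space L) (x y : ℝ) :
    ‖primitive L w y - primitive L w x‖ ≤ √|y - x| * ‖w‖ := by
  wlog hxy : x ≤ y generalizing x y
  · rw [norm_sub_rev, abs_sub_comm]
    exact this y x (le_of_not_ge hxy)
  rw [← abs_of_nonneg (norm_nonneg (_ - _)), ← Real.sqrt_sq_eq_abs,
    abs_of_nonneg (sub_nonneg.2 hxy)]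
  rw [← Real.sqrt_sq (norm_nonneg w), ← Real.sqrt_mul (sub_nonneg.2 hxy)]
  exact Real.sqrt_le_sqrt (norm_primitive_sub_sq_le w hxy)

lemma norm_primitive_le (w : L2Space L) {x : ℝ} (hx : x ∈ Icc 0 L) :
    ‖primitive L w x‖ ≤ √L * ‖w‖ := by
  have := norm_primitive_sub_le w 0 x
  rw [primitive_zero, sub_zero, sub_zero, abs_of_nonneg hx.1] at this
  exact this.trans (by gcongr; exact hx.2)

lemma primitive_add (v w : L2Space L) (x : ℝ) :
    primitive L (v + w : L2Space L) x = primitive L v x + primitive L w x := by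
  rw [primitive_congr (Lp.coeFn_add v w)]
  simp only [primitive]
  rw [← intervalIntegral.integral_add
    (integrable_indicator_of_integrableOn v.integrableOn).intervalIntegrable
    (integrable_indicator_of_integrableOn w.integrableOn).intervalIntegrable]
  congr 1
  funext t
  by_cases ht : t ∈ Ioo 0 L <;> simp [ht]

lemma primitive_smul (c : ℝ) (w : L2Space L) (x : ℝ) :
    primitive L (c • w : L2Space L) x = c • primitive L w x := by
  rw [primitive_congr (Lp.coeFn_smul c w)]
  simp only [primitive]
  rw [← intervalIntegral.integral_smul]
  congr 1
  funext t
  by_cases ht : t ∈ Ioo 0 L <;> simp [ht]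

/-- The value at `x` of the primitive, as a bounded linear functional on `L²`. -/
def primitiveAt (L x : ℝ) : L2Space L →L[ℝ] E3 :=
  LinearMap.mkContinuous
    { toFun := fun w => primitive L w x
      map_add' := fun v w => primitive_add v w x
      map_smul' := fun c w => primitive_smul c w x } √|x| fun w => by
    simpa [primitive_zero] using norm_primitive_sub_le w 0 x

@[simp] lemma primitiveAt_apply (L x : ℝ) (w : L2Space L) :
    primitiveAt L x w = primitive L w x := rfl

lemma memLp_of_continuous {f : ℝ → E3} (hf : Continuous f) : MemLp f 2 (intervalMeasure L) := by
  obtain ⟨C, hC⟩ := isCompact_Icc.exists_bound_of_continuousOn (s := Icc 0 L) hf.continuousOn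
  refine MemLp.of_bound hf.aestronglyMeasurable C ?_
  filter_upwards [ae_restrict_mem measurableSet_Ioo] with x hx
  exact hC x (Ioo_subset_Icc_self hx)

/-- The primitive as a bounded linear operator on `L²`. -/
def primitiveL (L : ℝ) : L2Space L →L[ℝ] L2Space L :=
  LinearMap.mkContinuous
    { toFun := fun w => (memLp_of_continuous (continuous_primitive w.integrableOn)).toLp _
      map_add' := fun v w => by
        rw [← MemLp.toLp_add]
        congr 1
        funext x
        exact primitive_add v w x
      map_smul' := fun c w => by
        rw [RingHom.id_apply, ← MemLp.toLp_const_smul]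
        congr 1
        funext x
        exact primitive_smul c w x }
    ((intervalMeasure L).real univ ^ (2 : ENNReal).toReal⁻¹ * √L) fun w => by
      rw [mul_assoc]
      refine Lp.norm_le_of_ae_bound (by positivity) ?_
      filter_upwards [(memLp_of_continuous (continuous_primitive w.integrableOn)).coeFn_toLp,
        ae_restrict_mem measurableSet_Ioo] with x hx hxI
      simp only [LinearMap.coe_mk, AddHom.coe_mk]
      rw [hx]
      exact norm_primitive_le w (Ioo_subset_Icc_self hxI)

lemma coeFn_primitiveL (w : L2Space L) : primitiveL L w =ᵐ[intervalMeasure L] primitive L w :=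
  (memLp_of_continuous (continuous_primitive w.integrableOn)).coeFn_toLp

end Primitive

section Evaluation

variable {L : ℝ}

/-- The value at `0` of an `H¹` function `u` with `u' = w`: the mean value of `u - ∫₀ˣ w`. -/
def initialValue (L : ℝ) : L2Space L × L2Space L →L[ℝ] E3 :=
  L⁻¹ • (primitiveAt L L).comp
    (ContinuousLinearMap.fst ℝ _ _ - (primitiveL L).comp (ContinuousLinearMap.snd ℝ _ _))

/-- Point evaluation at `x ∈ [0, L]` of an `H¹` function `u` with `u' = w`, as a bounded linear map
of `(u, w) ∈ L² × L²`. -/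
def evalAt (L x : ℝ) : L2Space L × L2Space L →L[ℝ] E3 :=
  initialValue L + (primitiveAt L x).comp (ContinuousLinearMap.snd ℝ _ _)

lemma evalAt_apply (x : ℝ) (p : L2Space L × L2Space L) :
    evalAt L x p = initialValue L p + primitive L p.2 x := rfl

lemma continuous_evalAt (p : L2Space L × L2Space L) : Continuous fun x => evalAt L x p :=
  continuous_const.add (continuous_primitive p.2.integrableOn)

lemma evalAt_sub (p : L2Space L × L2Space L) (x y : ℝ) :
    evalAt L y p - evalAt L x p = primitive L p.2 y - primitive L p.2 x := by
  simp only [evalAt_apply]; abel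

lemma initialValue_eq (hL : 0 < L) {u w : L2Space L} {C : E3}
    (h : u =ᵐ[intervalMeasure L] fun x => C + primitive L w x) : initialValue L (u, w) = C := by
  have h1 : (u - primitiveL L w : L2Space L) =ᵐ[intervalMeasure L] fun _ => C := by
    filter_upwards [Lp.coeFn_sub u (primitiveL L w), coeFn_primitiveL w, h] with x h1 h2 h3
    rw [h1, Pi.sub_apply, h2, h3, add_sub_cancel_right]
  have h2 : primitive L (u - primitiveL L w : L2Space L) L = L • C := by
    rw [primitive_congr h1, primitive, intervalIntegral.integral_of_le hL.le,
      integral_Ioc_eq_integral_Ioo, setIntegral_congr_fun measurableSet_Ioo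
        (g := fun _ => C) (fun x hx => indicator_of_mem hx _)]
    simp [hL.le]
  change L⁻¹ • primitive L (u - primitiveL L w : L2Space L) L = C
  rw [h2, inv_smul_smul₀ hL.ne']

/-- An `H¹` function agrees almost everywhere with the continuous function of its point values. -/
lemma HasWeakDeriv.ae_eq_evalAt (hL : 0 < L) {u w : L2Space L} (h : HasWeakDeriv L u w) :
    u =ᵐ[intervalMeasure L] fun x => evalAt L x (u, w) := by
  obtain ⟨C, hC⟩ := h.exists_ae_eq hL u.integrableOn w.integrableOn
  filter_upwards [hC] with x hx
  rw [hx, evalAt_apply, initialValue_eq hL hC]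

lemma contRep_eq (hL : 0 < L) {u g : ℝ → E3} (hg : ContinuousOn g (Icc 0 L))
    (h : u =ᵐ[intervalMeasure L] g) {x : ℝ} (hx : x ∈ Icc 0 L) : contRep L u x = g x := by
  have hex : ∃ g : ℝ → E3, ContinuousOn g (Icc 0 L) ∧ u =ᵐ[intervalMeasure L] g := ⟨g, hg, h⟩
  rw [contRep, dif_pos hex]
  have hc := hex.choose_spec
  refine Measure.eqOn_Icc_of_ae_eq volume hL.ne ?_ hc.1 hg hx
  rw [restrict_Ioo_eq_restrict_Icc.symm]
  exact hc.2.symm.trans h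

lemma HasWeakDeriv.contRep_eq (hL : 0 < L) {u w : L2Space L} (h : HasWeakDeriv L u w) {x : ℝ}
    (hx : x ∈ Icc 0 L) : contRep L u x = evalAt L x (u, w) :=
  Ribbon.contRep_eq hL (continuous_evalAt (u, w)).continuousOn (h.ae_eq_evalAt hL) hx

end Evaluation

/-! ### The energy densities -/

section Density

lemma measurable_Qbar : Measurable fun p : ℝ × ℝ => Qbar p.1 p.2 := by
  unfold Qbar
  exact Measurable.ite (measurableSet_le (by fun_prop) (by fun_prop)) (by fun_prop) (by fun_prop)

lemma Qbar_nonneg (α β : ℝ) : 0 ≤ Qbar α β := by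
  unfold Qbar
  split_ifs <;> positivity

lemma Qbar_zero_zero : Qbar 0 0 = 0 := by simp [Qbar]

lemma Qbar_le (α β : ℝ) : Qbar α β ≤ 4 * (α ^ 2 + β ^ 2) := by
  unfold Qbar
  split_ifs with h
  · have h2 : β ^ 2 ≤ α ^ 2 := sq_le_sq.mpr h
    refine div_le_of_le_mul₀ (by positivity) (by positivity) ?_
    nlinarith [sq_nonneg α, sq_nonneg β]
  · nlinarith [sq_nonneg α]

/-- `Q̄(α, β)` is the minimum over `s ≥ |α|` of the convex expression `2β² + s² + β⁴/s²`, attained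
at `s = max |α| |β|`. -/
lemma Qbar_eq (α β : ℝ) :
    Qbar α β = 2 * β ^ 2 + max |α| |β| ^ 2 + (β ^ 2 / max |α| |β|) ^ 2 := by
  unfold Qbar
  split_ifs with h
  · rw [max_eq_left h, div_pow, sq_abs]
    rcases eq_or_ne α 0 with rfl | hα
    · have : β = 0 := by simpa using h
      simp [this]
    · field_simp
      ring
  · push Not at h
    rw [max_eq_right h.le, div_pow, sq_abs]
    have hβ : β ≠ 0 := by
      rintro rfl
      exact absurd h (by simp)
    field_simp
    ring

/-- `Q̄(α, β)` lies below `2β² + s² + β⁴/s²` for every positive `s ≥ |α|`. -/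
lemma Qbar_le_of_le {α β s : ℝ} (hs : 0 < s) (hα : |α| ≤ s) :
    Qbar α β ≤ 2 * β ^ 2 + s ^ 2 + (β ^ 2 / s) ^ 2 := by
  have hα2 : α ^ 2 ≤ s ^ 2 := by
    rw [← sq_abs α]
    gcongr
  unfold Qbar
  split_ifs with h
  · have h2 : β ^ 2 ≤ α ^ 2 := sq_le_sq.mpr h
    rcases eq_or_ne α 0 with rfl | hα0
    · simp only [ne_eq, OfNat.ofNat_ne_zero, not_false_eq_true, zero_pow, div_zero]
      positivity
    · have hpos : 0 < α ^ 2 := by positivity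
      have key : 0 ≤ (s ^ 2 - α ^ 2) * (s ^ 2 * α ^ 2 - β ^ 2 * β ^ 2) :=
        mul_nonneg (sub_nonneg.2 hα2)
          (sub_nonneg.2 (mul_le_mul (h2.trans hα2) h2 (sq_nonneg _) (sq_nonneg _)))
      rw [div_pow, div_le_iff₀ hpos, ← sub_nonneg]
      have : (2 * β ^ 2 + s ^ 2 + (β ^ 2) ^ 2 / s ^ 2) * α ^ 2 - (α ^ 2 + β ^ 2) ^ 2
          = (s ^ 2 - α ^ 2) * (s ^ 2 * α ^ 2 - β ^ 2 * β ^ 2) / s ^ 2 := by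
        field_simp
        ring
      rw [this]
      positivity
  · have : s * (β ^ 2 / s) = β ^ 2 := by field_simp
    nlinarith [sq_nonneg (s - β ^ 2 / s)]

/-- Convexity of the corrected Sadowsky density as a function of the vectors `y''` and `b'`. -/
lemma Qbar_norm_convex {E : Type*} [NormedAddCommGroup E] [NormedSpace ℝ E] (a₁ a₂ b₁ b₂ : E)
    {t₁ t₂ : ℝ} (ht₁ : 0 ≤ t₁) (ht₂ : 0 ≤ t₂) (ht : t₁ + t₂ = 1) :
    Qbar ‖t₁ • a₁ + t₂ • a₂‖ ‖t₁ • b₁ + t₂ • b₂‖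
      ≤ t₁ * Qbar ‖a₁‖ ‖b₁‖ + t₂ * Qbar ‖a₂‖ ‖b₂‖ := by
  have hnorm : ∀ x y : E, ‖t₁ • x + t₂ • y‖ ≤ t₁ * ‖x‖ + t₂ * ‖y‖ := fun x y =>
    (norm_add_le _ _).trans_eq (by
      rw [norm_smul, norm_smul, Real.norm_of_nonneg ht₁, Real.norm_of_nonneg ht₂])
  rw [Qbar_eq ‖a₁‖, Qbar_eq ‖a₂‖]
  simp only [abs_norm]
  -- the convex combination of the two minimizers is admissible for the combined vectors
  set s₁ := max ‖a₁‖ ‖b₁‖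
  set s₂ := max ‖a₂‖ ‖b₂‖
  have hs₁ : 0 ≤ s₁ := (norm_nonneg _).trans (le_max_left _ _)
  have hs₂ : 0 ≤ s₂ := (norm_nonneg _).trans (le_max_left _ _)
  have hA : ‖t₁ • a₁ + t₂ • a₂‖ ≤ t₁ * s₁ + t₂ * s₂ :=
    (hnorm _ _).trans (by gcongr <;> exact le_max_left _ _)
  have hB : ‖t₁ • b₁ + t₂ • b₂‖ ≤ t₁ * s₁ + t₂ * s₂ :=
    (hnorm _ _).trans (by gcongr <;> exact le_max_right _ _)
  have hs0 : 0 ≤ t₁ * s₁ + t₂ * s₂ := by positivity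
  rcases hs0.eq_or_lt with hs | hs
  · rw [le_antisymm (hA.trans_eq hs.symm) (norm_nonneg _),
      le_antisymm (hB.trans_eq hs.symm) (norm_nonneg _), Qbar_zero_zero]
    positivity
  refine (Qbar_le_of_le hs (by rwa [abs_norm])).trans ?_
  -- also true for `s = 0`, where the quotient is zero by convention
  have hr : ∀ {β s : ℝ}, 0 ≤ β → β ≤ s → β ^ 2 / s * s = β ^ 2 := by
    intro β s h0 h1
    rcases eq_or_ne s 0 with rfl | h2
    · simp [le_antisymm h1 h0]
    · field_simp
  have hr₁ := hr (norm_nonneg b₁) (le_max_right ‖a₁‖ ‖b₁‖)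
  have hr₂ := hr (norm_nonneg b₂) (le_max_right ‖a₂‖ ‖b₂‖)
  have hr₁0 : 0 ≤ ‖b₁‖ ^ 2 / s₁ := by positivity
  have hr₂0 : 0 ≤ ‖b₂‖ ^ 2 / s₂ := by positivity
  have hb := hnorm b₁ b₂
  set β := ‖t₁ • b₁ + t₂ • b₂‖
  set β₁ := ‖b₁‖
  set β₂ := ‖b₂‖
  set r₁ := β₁ ^ 2 / s₁
  set r₂ := β₂ ^ 2 / s₂
  change r₁ * s₁ = _ at hr₁
  change r₂ * s₂ = _ at hr₂
  have hβ₁ : 0 ≤ β₁ := norm_nonneg _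
  have hβ₂ : 0 ≤ β₂ := norm_nonneg _
  have hβ : 0 ≤ β := norm_nonneg _
  have hconv : ∀ x y : ℝ, (t₁ * x + t₂ * y) ^ 2 ≤ t₁ * x ^ 2 + t₂ * y ^ 2 := by
    intro x y
    have : t₁ * x ^ 2 + t₂ * y ^ 2 - (t₁ * x + t₂ * y) ^ 2 = t₁ * t₂ * (x - y) ^ 2 := by
      obtain rfl : t₂ = 1 - t₁ := by linarith
      ring
    nlinarith [mul_nonneg (mul_nonneg ht₁ ht₂) (sq_nonneg (x - y))]
  have hβsq : β ^ 2 ≤ (t₁ * β₁ + t₂ * β₂) ^ 2 := by gcongr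
  have hcross : 2 * (β₁ * β₂) ≤ s₁ * r₂ + s₂ * r₁ := by
    refine le_of_sq_le_sq ?_ (by positivity)
    have : (2 * (β₁ * β₂)) ^ 2 = 4 * (s₁ * r₂) * (s₂ * r₁) := by
      rw [show 4 * (s₁ * r₂) * (s₂ * r₁) = 4 * (r₁ * s₁) * (r₂ * s₂) by ring, hr₁, hr₂]
      ring
    rw [this]
    nlinarith [sq_nonneg (s₁ * r₂ - s₂ * r₁)]
  -- joint convexity of `(β, s) ↦ β² / s`
  have hquot : β ^ 2 / (t₁ * s₁ + t₂ * s₂) ≤ t₁ * r₁ + t₂ * r₂ := by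
    rw [div_le_iff₀ hs]
    refine hβsq.trans ?_
    have h1 := mul_le_mul_of_nonneg_left hcross (mul_nonneg ht₁ ht₂)
    have h2 : (t₁ * r₁ + t₂ * r₂) * (t₁ * s₁ + t₂ * s₂)
        = t₁ ^ 2 * (r₁ * s₁) + t₂ ^ 2 * (r₂ * s₂) + t₁ * t₂ * (s₁ * r₂ + s₂ * r₁) := by ring
    rw [h2, hr₁, hr₂]
    linarith
  have hquot2 : (β ^ 2 / (t₁ * s₁ + t₂ * s₂)) ^ 2 ≤ (t₁ * r₁ + t₂ * r₂) ^ 2 := by gcongr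
  linarith [hconv β₁ β₂, hconv s₁ s₂, hconv r₁ r₂]

lemma IsRegularizedModulus.measurable {m : ℝ → ℝ → ℝ} {c₀ c₁ c₂ cuni δ : ℝ}
    (hm : IsRegularizedModulus m c₀ c₁ c₂ cuni) (hδ : 0 ≤ δ) : Measurable (m δ) := by
  rcases hδ.eq_or_lt with rfl | hδ
  · have : m 0 = fun x => |x| := funext fun x => by
      have := hm.uniform 0 le_rfl x
      rw [mul_zero] at this
      exact sub_eq_zero.mp (abs_nonpos_iff.mp this)
    rw [this]
    exact measurable_id.abs
  · exact (hm.contDiff δ hδ).continuous.measurable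

lemma measurable_Qreg {m : ℝ → ℝ → ℝ} {c₀ c₁ c₂ cuni δ : ℝ}
    (hm : IsRegularizedModulus m c₀ c₁ c₂ cuni) (hδ : 0 ≤ δ) :
    Measurable fun p : ℝ × ℝ => Qreg m δ p.1 p.2 := by
  have h := hm.measurable hδ
  unfold Qreg
  fun_prop

lemma Qreg_nonneg {m : ℝ → ℝ → ℝ} {c₀ c₁ c₂ cuni δ : ℝ}
    (hm : IsRegularizedModulus m c₀ c₁ c₂ cuni) (hδ : 0 ≤ δ) (α β : ℝ) : 0 ≤ Qreg m δ α β := by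
  have := hm.nonneg δ hδ (α ^ 2 - β ^ 2)
  unfold Qreg
  positivity

/-- The regularized density converges to `Q̄` uniformly. -/
lemma abs_Qreg_sub_Qbar_le {m : ℝ → ℝ → ℝ} {c₀ c₁ c₂ cuni δ : ℝ}
    (hm : IsRegularizedModulus m c₀ c₁ c₂ cuni) (hδ : 0 ≤ δ) (α β : ℝ) :
    |Qreg m δ α β - Qbar α β| ≤ 3 * (cuni * δ) := by
  rw [← Qreg_zero hm]
  have h0 : m 0 (α ^ 2 - β ^ 2) = |α ^ 2 - β ^ 2| := by
    have := hm.uniform 0 le_rfl (α ^ 2 - β ^ 2)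
    rw [mul_zero] at this
    exact sub_eq_zero.mp (abs_nonpos_iff.mp this)
  have h1 := hm.uniform δ hδ (α ^ 2 - β ^ 2)
  have h2 := hm.nonneg δ hδ (α ^ 2 - β ^ 2)
  unfold Qreg
  rw [h0]
  set D := |α ^ 2 - β ^ 2|
  set M := m δ (α ^ 2 - β ^ 2)
  have hD : 0 ≤ D := abs_nonneg _
  have hq : |2 * β ^ 4 / (α ^ 2 + β ^ 2 + M) - 2 * β ^ 4 / (α ^ 2 + β ^ 2 + D)|
      ≤ 2 * |M - D| := by
    rcases eq_or_ne β 0 with rfl | hβ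
    · simp
    · have hβ2 : 0 < β ^ 2 := by positivity
      have e1 : β ^ 2 ≤ α ^ 2 + β ^ 2 + M := by nlinarith [sq_nonneg α]
      have e2 : β ^ 2 ≤ α ^ 2 + β ^ 2 + D := by nlinarith [sq_nonneg α]
      have p1 := hβ2.trans_le e1
      have p2 := hβ2.trans_le e2
      rw [div_sub_div _ _ p1.ne' p2.ne', abs_div, abs_of_pos (mul_pos p1 p2),
        div_le_iff₀ (mul_pos p1 p2)]
      have : 2 * β ^ 4 * (α ^ 2 + β ^ 2 + D) - (α ^ 2 + β ^ 2 + M) * (2 * β ^ 4)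
          = -(2 * β ^ 4 * (M - D)) := by ring
      rw [this, abs_neg, abs_mul, abs_of_nonneg (by positivity : (0 : ℝ) ≤ 2 * β ^ 4)]
      have h4 : β ^ 2 * β ^ 2 ≤ (α ^ 2 + β ^ 2 + M) * (α ^ 2 + β ^ 2 + D) :=
        mul_le_mul e1 e2 hβ2.le p1.le
      nlinarith [abs_nonneg (M - D), mul_le_mul_of_nonneg_left h4 (abs_nonneg (M - D))]
  have hsplit : 2 * β ^ 2 + α ^ 2 / 2 + β ^ 2 / 2 + M / 2 + 2 * β ^ 4 / (α ^ 2 + β ^ 2 + M)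
      - (2 * β ^ 2 + α ^ 2 / 2 + β ^ 2 / 2 + D / 2 + 2 * β ^ 4 / (α ^ 2 + β ^ 2 + D))
      = (M - D) / 2
        + (2 * β ^ 4 / (α ^ 2 + β ^ 2 + M) - 2 * β ^ 4 / (α ^ 2 + β ^ 2 + D)) := by ring
  rw [hsplit]
  refine (abs_add_le _ _).trans ?_
  rw [abs_div, abs_of_pos (by norm_num : (0 : ℝ) < 2)]
  linarith [abs_nonneg (M - D)]

end Density

/-! ### Weak convergence -/

section WeakConvergence

variable {X : Type*} [NormedAddCommGroup X] [NormedSpace ℝ X]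

/-- Weakly convergent sequences are bounded. -/
lemma exists_norm_le_of_weak_tendsto {u : ℕ → X} {v : X}
    (h : ∀ l : X →L[ℝ] ℝ, Tendsto (fun n => l (u n)) atTop (𝓝 (l v))) :
    ∃ C, 0 ≤ C ∧ ∀ n, ‖u n‖ ≤ C := by
  obtain ⟨C, hC⟩ := banach_steinhaus (g := fun n => NormedSpace.inclusionInDoubleDual ℝ X (u n))
    fun l => by
      obtain ⟨C, hC⟩ := (h l).norm.bddAbove_range
      exact ⟨C, fun n => hC ⟨n, rfl⟩⟩
  have hC' : ∀ n, ‖u n‖ ≤ C := fun n => by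
    have := (NormedSpace.inclusionInDoubleDualLi ℝ (E := X)).norm_map (u n)
    rw [← this]
    exact hC n
  exact ⟨C, (norm_nonneg _).trans (hC' 0), hC'⟩

/-- Continuous convex functions are weakly lower semicontinuous. -/
lemma le_of_weak_tendsto_of_convexOn {Φ : X → ℝ} (hΦ : ConvexOn ℝ univ Φ) (hc : Continuous Φ)
    {u : ℕ → X} {v : X} (h : ∀ l : X →L[ℝ] ℝ, Tendsto (fun n => l (u n)) atTop (𝓝 (l v)))
    {a : ℝ} (ha : ∀ᶠ n in atTop, Φ (u n) ≤ a) : Φ v ≤ a := by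
  by_contra hv
  have hconv : Convex ℝ {x | Φ x ≤ a} := by simpa using hΦ.convex_le a
  obtain ⟨f, r, h1, h2⟩ := geometric_hahn_banach_closed_point hconv
    (isClosed_le hc continuous_const) (x := v) hv
  obtain ⟨n, h3, h4⟩ := (((h f).eventually_const_lt h2).and ha).exists
  exact lt_asymm h3 (h1 _ h4)

/-- Images of weakly convergent sequences under bounded linear maps to three-space converge. -/
lemma tendsto_of_weak_tendsto {u : ℕ → X} {v : X}
    (h : ∀ l : X →L[ℝ] ℝ, Tendsto (fun n => l (u n)) atTop (𝓝 (l v))) (A : X →L[ℝ] E3) :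
    Tendsto (fun n => A (u n)) atTop (𝓝 (A v)) := by
  rw [(EuclideanSpace.equiv (Fin 3) ℝ).toHomeomorph.isInducing.tendsto_nhds_iff, tendsto_pi_nhds]
  exact fun i => h ((EuclideanSpace.proj i : E3 →L[ℝ] ℝ).comp A)

/-- Weak convergence in `H¹(0, L)` implies uniform convergence: the point values converge, and the
functions are equi-Hölder. -/
lemma tendstoUniformlyOn_evalAt {L : ℝ} {p : ℕ → L2Space L × L2Space L} {q : L2Space L × L2Space L}
    (h : ∀ l : L2Space L × L2Space L →L[ℝ] ℝ, Tendsto (fun n => l (p n)) atTop (𝓝 (l q))) :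
    TendstoUniformlyOn (fun n x => evalAt L x (p n)) (fun x => evalAt L x q) atTop (Icc 0 L) := by
  obtain ⟨C, hC0, hC⟩ := exists_norm_le_of_weak_tendsto h
  have heq : Equicontinuous fun (n : ℕ) (x : ℝ) => evalAt L x (p n) := by
    intro x
    rw [Metric.equicontinuousAt_iff_right]
    intro ε hε
    have hcont : Tendsto (fun y => √|y - x| * C) (𝓝 x) (𝓝 0) := by
      have : Continuous fun y => √|y - x| * C := by fun_prop
      simpa using this.tendsto x
    filter_upwards [hcont.eventually_lt_const hε] with y hy n
    rw [dist_comm, dist_eq_norm, evalAt_sub]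
    refine ((norm_primitive_sub_le (p n).2 x y).trans ?_).trans_lt hy
    gcongr
    exact (norm_snd_le _).trans (hC n)
  have := (EquicontinuousOn.tendsto_uniformOnFun_iff_pi' (𝔖 := {Icc 0 L}) (by simp [isCompact_Icc])
    (fun K _ => heq.equicontinuousOn K) atTop (fun x => evalAt L x q)).2 (by
      rw [tendsto_pi_nhds]
      exact fun x => tendsto_of_weak_tendsto h (evalAt L x))
  exact UniformOnFun.tendsto_iff_tendstoUniformlyOn.1 this _ (mem_singleton _)

end WeakConvergence

/-! ### The energy with frozen tangent -/

section LimitFunctional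

variable {L : ℝ}

lemma integrableOn_of_abs_le_norm_sq (w : L2Space L) {f : ℝ → ℝ}
    (hf : AEStronglyMeasurable f (intervalMeasure L)) {K : ℝ}
    (h : ∀ᵐ x ∂(intervalMeasure L), |f x| ≤ K * ‖w x‖ ^ 2) : IntegrableOn f (Ioo 0 L) :=
  (w.integrableOn_norm_sq.const_mul K).mono' hf h

lemma aestronglyMeasurable_coe (w : L2Space L) : AEStronglyMeasurable w (intervalMeasure L) :=
  Lp.aestronglyMeasurable w

lemma integrableOn_Qbar (p : L2Space L × L2Space L) :
    IntegrableOn (fun x => Qbar ‖p.1 x‖ ‖p.2 x‖) (Ioo 0 L) := by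
  refine ((p.1.integrableOn_norm_sq.add p.2.integrableOn_norm_sq).const_mul 4).mono' ?_ ?_
  · exact (measurable_Qbar.comp_aemeasurable
      ((aestronglyMeasurable_coe p.1).norm.aemeasurable.prodMk
        (aestronglyMeasurable_coe p.2).norm.aemeasurable)).aestronglyMeasurable
  · refine Eventually.of_forall fun x => ?_
    rw [Real.norm_of_nonneg (Qbar_nonneg _ _)]
    exact Qbar_le _ _

lemma integrableOn_Qreg {m : ℝ → ℝ → ℝ} {c₀ c₁ c₂ cuni δ : ℝ}
    (hm : IsRegularizedModulus m c₀ c₁ c₂ cuni) (hδ : 0 ≤ δ) (p : L2Space L × L2Space L) :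
    IntegrableOn (fun x => Qreg m δ ‖p.1 x‖ ‖p.2 x‖) (Ioo 0 L) := by
  refine ((integrableOn_Qbar p).add (integrable_const (3 * (cuni * δ)))).mono' ?_ ?_
  · exact ((measurable_Qreg hm hδ).comp_aemeasurable
      ((aestronglyMeasurable_coe p.1).norm.aemeasurable.prodMk
        (aestronglyMeasurable_coe p.2).norm.aemeasurable)).aestronglyMeasurable
  · refine Eventually.of_forall fun x => ?_
    rw [Real.norm_of_nonneg (Qreg_nonneg hm hδ _ _)]
    have := (abs_le.1 (abs_Qreg_sub_Qbar_le hm hδ ‖p.1 x‖ ‖p.2 x‖)).2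
    simp only [Pi.add_apply]
    linarith

lemma exists_bound_Icc {P : ℝ → E3} (hP : Continuous P) :
    ∃ M, 0 ≤ M ∧ ∀ x ∈ Icc 0 L, ‖P x‖ ≤ M := by
  obtain ⟨M, hM⟩ := isCompact_Icc.exists_bound_of_continuousOn (s := Icc 0 L) hP.continuousOn
  exact ⟨max M 0, le_max_right _ _, fun x hx => (hM x hx).trans (le_max_left _ _)⟩

lemma inner_sq_le {M : ℝ} {a b : E3} (ha : ‖a‖ ≤ M) : inner ℝ a b ^ 2 ≤ M ^ 2 * ‖b‖ ^ 2 := by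
  rw [← mul_pow, ← sq_abs]
  have := abs_real_inner_le_norm a b
  gcongr
  exact this.trans (by gcongr)

lemma integrableOn_inner_sq {P : ℝ → E3} (hP : Continuous P) (w : L2Space L) :
    IntegrableOn (fun x => inner ℝ (P x) (w x) ^ 2) (Ioo 0 L) := by
  obtain ⟨M, -, hM⟩ := exists_bound_Icc (L := L) hP
  refine integrableOn_of_abs_le_norm_sq w (K := M ^ 2) ?_ ?_
  · exact (hP.aestronglyMeasurable.inner (aestronglyMeasurable_coe w)).pow 2
  · filter_upwards [ae_restrict_mem measurableSet_Ioo] with x hx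
    rw [abs_of_nonneg (sq_nonneg _)]
    exact inner_sq_le (hM x (Ioo_subset_Icc_self hx))

/-- The limit energy as a function of the highest derivatives `(y'', b')`, with the field `P`, which
stands for the limit of the tangents `y'`, frozen in the penalty term. -/
def frozenEnergy (L κ : ℝ) (P : ℝ → E3) (p : L2Space L × L2Space L) : ℝ :=
  (∫ x in Ioo 0 L, Qbar ‖p.1 x‖ ‖p.2 x‖) + κ * ∫ x in Ioo 0 L, inner ℝ (P x) (p.2 x) ^ 2

/-- Unlike the energy in which `P` is replaced by `y'`, the frozen energy is convex. -/
lemma convexOn_frozenEnergy {κ : ℝ} (hκ : 0 ≤ κ) {P : ℝ → E3} (hP : Continuous P) :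
    ConvexOn ℝ univ (frozenEnergy L κ P) := by
  refine ⟨convex_univ, fun p _ q _ s t hs ht hst => ?_⟩
  have hc : ∀ v w : L2Space L, (s • v + t • w : L2Space L) =ᵐ[intervalMeasure L]
      fun x => s • v x + t • w x := fun v w => by
    filter_upwards [Lp.coeFn_add (s • v) (t • w), Lp.coeFn_smul s v, Lp.coeFn_smul t w]
      with x h1 h2 h3
    rw [h1, Pi.add_apply, h2, h3, Pi.smul_apply, Pi.smul_apply]
  have h1 : ∫ x in Ioo 0 L, Qbar ‖(s • p + t • q).1 x‖ ‖(s • p + t • q).2 x‖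
      ≤ s * (∫ x in Ioo 0 L, Qbar ‖p.1 x‖ ‖p.2 x‖) + t * ∫ x in Ioo 0 L, Qbar ‖q.1 x‖ ‖q.2 x‖ := by
    rw [← integral_const_mul, ← integral_const_mul,
      ← integral_add ((integrableOn_Qbar p).const_mul s) ((integrableOn_Qbar q).const_mul t)]
    refine integral_mono_ae (integrableOn_Qbar _)
      (((integrableOn_Qbar p).const_mul s).add ((integrableOn_Qbar q).const_mul t)) ?_
    filter_upwards [hc p.1 q.1, hc p.2 q.2] with x hx1 hx2
    simp only [Prod.fst_add, Prod.snd_add, Prod.smul_fst, Prod.smul_snd, hx1, hx2]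
    exact Qbar_norm_convex _ _ _ _ hs ht hst
  have h2 : ∫ x in Ioo 0 L, inner ℝ (P x) ((s • p + t • q).2 x) ^ 2
      ≤ s * (∫ x in Ioo 0 L, inner ℝ (P x) (p.2 x) ^ 2)
        + t * ∫ x in Ioo 0 L, inner ℝ (P x) (q.2 x) ^ 2 := by
    rw [← integral_const_mul, ← integral_const_mul,
      ← integral_add ((integrableOn_inner_sq hP p.2).const_mul s)
        ((integrableOn_inner_sq hP q.2).const_mul t)]
    refine integral_mono_ae (integrableOn_inner_sq hP _)
      (((integrableOn_inner_sq hP p.2).const_mul s).add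
        ((integrableOn_inner_sq hP q.2).const_mul t)) ?_
    filter_upwards [hc p.2 q.2] with x hx
    simp only [Prod.snd_add, Prod.smul_snd, hx, inner_add_right, real_inner_smul_right]
    exact (even_two.convexOn_pow (𝕜 := ℝ)).2 (mem_univ _) (mem_univ _) hs ht hst
  simp only [frozenEnergy, smul_eq_mul]
  have h3 := mul_le_mul_of_nonneg_left h2 hκ
  linarith

lemma frozenEnergy_le {κ M : ℝ} (hκ : 0 ≤ κ) {P : ℝ → E3} (hP : Continuous P)
    (hM : ∀ x ∈ Icc 0 L, ‖P x‖ ≤ M) (p : L2Space L × L2Space L) :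
    frozenEnergy L κ P p ≤ 4 * (‖p.1‖ ^ 2 + ‖p.2‖ ^ 2) + κ * (M ^ 2 * ‖p.2‖ ^ 2) := by
  have h1 : ∫ x in Ioo 0 L, Qbar ‖p.1 x‖ ‖p.2 x‖ ≤ 4 * (‖p.1‖ ^ 2 + ‖p.2‖ ^ 2) := by
    rw [p.1.norm_sq_eq, p.2.norm_sq_eq,
      ← integral_add p.1.integrableOn_norm_sq p.2.integrableOn_norm_sq, ← integral_const_mul]
    exact integral_mono (integrableOn_Qbar p)
      ((p.1.integrableOn_norm_sq.add p.2.integrableOn_norm_sq).const_mul 4) fun x => Qbar_le _ _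
  have h2 : ∫ x in Ioo 0 L, inner ℝ (P x) (p.2 x) ^ 2 ≤ M ^ 2 * ‖p.2‖ ^ 2 := by
    rw [p.2.norm_sq_eq, ← integral_const_mul]
    refine integral_mono_ae (integrableOn_inner_sq hP p.2)
      (p.2.integrableOn_norm_sq.const_mul _) ?_
    filter_upwards [ae_restrict_mem measurableSet_Ioo] with x hx
    exact inner_sq_le (hM x (Ioo_subset_Icc_self hx))
  unfold frozenEnergy
  gcongr

/-- A convex function that is bounded on a ball is continuous. -/
lemma continuous_frozenEnergy {κ : ℝ} (hκ : 0 ≤ κ) {P : ℝ → E3} (hP : Continuous P) :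
    Continuous (frozenEnergy L κ P) := by
  obtain ⟨M, hM0, hM⟩ := exists_bound_Icc (L := L) hP
  rw [← continuousOn_univ]
  refine (((convexOn_frozenEnergy hκ hP).continuousOn_tfae isOpen_univ univ_nonempty).out 3 1).mp ?_
  refine ⟨0, mem_univ _, 4 * (1 ^ 2 + 1 ^ 2) + κ * (M ^ 2 * 1 ^ 2), ?_⟩
  rw [eventually_map]
  filter_upwards [Metric.ball_mem_nhds (0 : L2Space L × L2Space L) one_pos] with p hp
  rw [mem_ball_zero_iff] at hp
  have h1 := (norm_fst_le p).trans hp.le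
  have h2 := (norm_snd_le p).trans hp.le
  refine (frozenEnergy_le hκ hP hM p).trans ?_
  gcongr

end LimitFunctional

/-! ### Components of a pair and comparison of energies -/

section Components

variable {L : ℝ}

/-- The `i`-th derivative of `y`, as a bounded linear map. -/
def yComp (L : ℝ) (i : Fin 3) : PairSpace L →L[ℝ] L2Space L :=
  ((PiLp.proj 2 (fun _ : Fin 3 => L2Space L) i : _ →L[ℝ] L2Space L).comp
    (Sobolev 2 L).subtypeL).comp (ContinuousLinearMap.fst ℝ _ _)

/-- The `i`-th derivative of `b`, as a bounded linear map. -/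
def bComp (L : ℝ) (i : Fin 2) : PairSpace L →L[ℝ] L2Space L :=
  ((PiLp.proj 2 (fun _ : Fin 2 => L2Space L) i : _ →L[ℝ] L2Space L).comp
    (Sobolev 1 L).subtypeL).comp (ContinuousLinearMap.snd ℝ _ _)

/-- The pair `(y, y')`. -/
def yPair (L : ℝ) : PairSpace L →L[ℝ] L2Space L × L2Space L := (yComp L 0).prod (yComp L 1)

/-- The pair `(y', y'')`. -/
def tangentPair (L : ℝ) : PairSpace L →L[ℝ] L2Space L × L2Space L := (yComp L 1).prod (yComp L 2)

/-- The pair `(b, b')`. -/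
def directorPair (L : ℝ) : PairSpace L →L[ℝ] L2Space L × L2Space L := (bComp L 0).prod (bComp L 1)

/-- The highest derivatives `(y'', b')`. -/
def topPair (L : ℝ) : PairSpace L →L[ℝ] L2Space L × L2Space L := (yComp L 2).prod (bComp L 1)

lemma hasWeakDeriv_yPair (v : PairSpace L) : HasWeakDeriv L (yPair L v).1 (yPair L v).2 := v.1.2 0

lemma hasWeakDeriv_tangentPair (v : PairSpace L) :
    HasWeakDeriv L (tangentPair L v).1 (tangentPair L v).2 := v.1.2 1

lemma hasWeakDeriv_directorPair (v : PairSpace L) :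
    HasWeakDeriv L (directorPair L v).1 (directorPair L v).2 := v.2.2 0

lemma contRep_yFun (hL : 0 < L) (v : PairSpace L) {x : ℝ} (hx : x ∈ Icc 0 L) :
    contRep L (yFun v) x = evalAt L x (yPair L v) := (hasWeakDeriv_yPair v).contRep_eq hL hx

lemma contRep_yDeriv (hL : 0 < L) (v : PairSpace L) {x : ℝ} (hx : x ∈ Icc 0 L) :
    contRep L (yDeriv v) x = evalAt L x (tangentPair L v) :=
  (hasWeakDeriv_tangentPair v).contRep_eq hL hx

lemma contRep_bFun (hL : 0 < L) (v : PairSpace L) {x : ℝ} (hx : x ∈ Icc 0 L) :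
    contRep L (bFun v) x = evalAt L x (directorPair L v) :=
  (hasWeakDeriv_directorPair v).contRep_eq hL hx

lemma yDeriv_ae_eq (hL : 0 < L) (v : PairSpace L) :
    yDeriv v =ᵐ[intervalMeasure L] fun x => evalAt L x (tangentPair L v) :=
  (hasWeakDeriv_tangentPair v).ae_eq_evalAt hL

lemma bFun_ae_eq (hL : 0 < L) (v : PairSpace L) :
    bFun v =ᵐ[intervalMeasure L] fun x => evalAt L x (directorPair L v) :=
  (hasWeakDeriv_directorPair v).ae_eq_evalAt hL

lemma norm_evalAt_le {x : ℝ} (hx : x ∈ Icc 0 L) (p : L2Space L × L2Space L) :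
    ‖evalAt L x p‖ ≤ (‖initialValue L‖ + √L) * ‖p‖ := by
  rw [evalAt_apply, add_mul]
  refine (norm_add_le _ _).trans (add_le_add ((initialValue L).le_opNorm p) ?_)
  exact (norm_primitive_le p.2 hx).trans (by gcongr; exact norm_snd_le p)

/-- The part of the discrete energy without the penalty for `y' · b = 0`. -/
def bulkEnergy {L : ℝ} (m : ℝ → ℝ → ℝ) (δ κ : ℝ) (v : PairSpace L) : ℝ :=
  (∫ x in Ioo 0 L, Qreg m δ ‖yDeriv2 v x‖ ‖bDeriv v x‖)
    + κ * ∫ x in Ioo 0 L, inner ℝ (yDeriv v x) (bDeriv v x) ^ 2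

lemma bulkEnergy_nonneg {m : ℝ → ℝ → ℝ} {c₀ c₁ c₂ cuni δ κ : ℝ}
    (hm : IsRegularizedModulus m c₀ c₁ c₂ cuni) (hδ : 0 ≤ δ) (hκ : 0 ≤ κ) (v : PairSpace L) :
    0 ≤ bulkEnergy m δ κ v := by
  have h1 : 0 ≤ ∫ x in Ioo 0 L, Qreg m δ ‖yDeriv2 v x‖ ‖bDeriv v x‖ :=
    integral_nonneg fun x => Qreg_nonneg hm hδ _ _
  have h2 : 0 ≤ ∫ x in Ioo 0 L, inner ℝ (yDeriv v x) (bDeriv v x) ^ 2 :=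
    integral_nonneg fun x => sq_nonneg _
  unfold bulkEnergy
  positivity

/-- Regularizing the density and unfreezing the tangent change the energy only a little. -/
lemma abs_bulkEnergy_sub_frozenEnergy_le (hL : 0 < L) {m : ℝ → ℝ → ℝ} {c₀ c₁ c₂ cuni δ κ M η : ℝ}
    (hm : IsRegularizedModulus m c₀ c₁ c₂ cuni) (hδ : 0 ≤ δ) (hκ : 0 ≤ κ) (v : PairSpace L)
    {P : ℝ → E3} (hP : Continuous P) (hPM : ∀ x ∈ Icc 0 L, ‖P x‖ ≤ M)
    (hη : ∀ x ∈ Icc 0 L, ‖evalAt L x (tangentPair L v) - P x‖ ≤ η) (hη1 : η ≤ 1) :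
    |bulkEnergy m δ κ v - frozenEnergy L κ P (topPair L v)|
      ≤ 3 * (cuni * δ) * L + κ * (η * (2 * M + 1) * ‖v‖ ^ 2) := by
  set w : L2Space L := bComp L 1 v with hw
  have hwv : ‖w‖ ≤ ‖v‖ := by
    have h1 : ‖w‖ ≤ ‖v.2.1‖ := PiLp.norm_apply_le v.2.1 1
    exact h1.trans (norm_snd_le v)
  have h1 : |(∫ x in Ioo 0 L, Qreg m δ ‖yDeriv2 v x‖ ‖bDeriv v x‖)
      - ∫ x in Ioo 0 L, Qbar ‖(topPair L v).1 x‖ ‖(topPair L v).2 x‖| ≤ 3 * (cuni * δ) * L := by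
    have hi := integrableOn_Qreg hm hδ (topPair L v)
    change |(∫ x in Ioo 0 L, Qreg m δ ‖(topPair L v).1 x‖ ‖(topPair L v).2 x‖) - _| ≤ _
    rw [← integral_sub hi (integrableOn_Qbar _), ← Real.norm_eq_abs]
    refine (norm_setIntegral_le_of_norm_le_const (by simp) fun x _ =>
      abs_Qreg_sub_Qbar_le hm hδ _ _).trans_eq ?_
    simp [hL.le]
  have h2 : |(∫ x in Ioo 0 L, inner ℝ (yDeriv v x) (bDeriv v x) ^ 2)
      - ∫ x in Ioo 0 L, inner ℝ (P x) (w x) ^ 2| ≤ η * (2 * M + 1) * ‖v‖ ^ 2 := by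
    have e1 : ∫ x in Ioo 0 L, inner ℝ (yDeriv v x) (bDeriv v x) ^ 2
        = ∫ x in Ioo 0 L, inner ℝ (evalAt L x (tangentPair L v)) (w x) ^ 2 :=
      integral_congr_ae ((yDeriv_ae_eq hL v).mono fun x hx => by
        simp only [hx]
        rfl)
    have hi := integrableOn_inner_sq (continuous_evalAt (tangentPair L v)) w
    rw [e1, ← integral_sub hi (integrableOn_inner_sq hP w), ← Real.norm_eq_abs]
    have hη0 : 0 ≤ η := (norm_nonneg _).trans (hη 0 ⟨le_rfl, hL.le⟩)
    have hM0 : 0 ≤ M := (norm_nonneg _).trans (hPM 0 ⟨le_rfl, hL.le⟩)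
    refine (norm_integral_le_of_norm_le
      (w.integrableOn_norm_sq.const_mul (η * (2 * M + 1))) ?_).trans ?_
    · filter_upwards [ae_restrict_mem measurableSet_Ioo] with x hx
      have hx' := Ioo_subset_Icc_self hx
      set A := evalAt L x (tangentPair L v)
      have hA : ‖A + P x‖ ≤ 2 * M + 1 := by
        have : A + P x = (A - P x) + (2 : ℝ) • P x := by rw [two_smul]; abel
        rw [this]
        refine (norm_add_le _ _).trans ?_
        rw [norm_smul, Real.norm_of_nonneg (by norm_num : (0 : ℝ) ≤ 2)]
        linarith [hη x hx', hPM x hx']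
      have : inner ℝ A (w x) ^ 2 - inner ℝ (P x) (w x) ^ 2
          = inner ℝ (A - P x) (w x) * inner ℝ (A + P x) (w x) := by
        rw [inner_sub_left, inner_add_left]
        ring
      rw [this, norm_mul]
      calc _ ≤ (‖A - P x‖ * ‖w x‖) * (‖A + P x‖ * ‖w x‖) := by
            gcongr <;> exact abs_real_inner_le_norm _ _
        _ ≤ (η * ‖w x‖) * ((2 * M + 1) * ‖w x‖) := by
            gcongr
            exact hη x hx'
        _ = _ := by ring
    · rw [integral_const_mul, ← w.norm_sq_eq]
      gcongr
  have h3 : bulkEnergy m δ κ v - frozenEnergy L κ P (topPair L v)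
      = ((∫ x in Ioo 0 L, Qreg m δ ‖yDeriv2 v x‖ ‖bDeriv v x‖)
      - ∫ x in Ioo 0 L, Qbar ‖(topPair L v).1 x‖ ‖(topPair L v).2 x‖)
      + κ * ((∫ x in Ioo 0 L, inner ℝ (yDeriv v x) (bDeriv v x) ^ 2)
      - ∫ x in Ioo 0 L, inner ℝ (P x) (w x) ^ 2) := by
    simp only [bulkEnergy, frozenEnergy, topPair, ContinuousLinearMap.prod_apply, ← hw]
    ring
  rw [h3]
  refine (abs_add_le _ _).trans (add_le_add h1 ?_)
  rw [abs_mul, abs_of_nonneg hκ]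
  gcongr

/-- Along weakly convergent sequences the bulk energy is asymptotically the energy with frozen limit
tangent. -/
lemma tendsto_bulkEnergy_sub_frozenEnergy (hL : 0 < L) {m : ℝ → ℝ → ℝ} {c₀ c₁ c₂ cuni κ : ℝ}
    (hm : IsRegularizedModulus m c₀ c₁ c₂ cuni) {δ : ℕ → ℝ} (hδ : ∀ n, 0 ≤ δ n)
    (hδ0 : Tendsto δ atTop (𝓝 0)) (hκ : 0 ≤ κ) {u : ℕ → PairSpace L} {v : PairSpace L}
    (h : ∀ l : PairSpace L →L[ℝ] ℝ, Tendsto (fun n => l (u n)) atTop (𝓝 (l v))) :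
    Tendsto (fun n => bulkEnergy m (δ n) κ (u n)
      - frozenEnergy L κ (fun x => evalAt L x (tangentPair L v)) (topPair L (u n)))
      atTop (𝓝 0) := by
  obtain ⟨C, hC0, hC⟩ := exists_norm_le_of_weak_tendsto h
  have hP := continuous_evalAt (tangentPair L v)
  obtain ⟨M, hM0, hM⟩ := exists_bound_Icc (L := L) hP
  have hunif := tendstoUniformlyOn_evalAt (p := fun n => tangentPair L (u n))
    (q := tangentPair L v) fun l => h (l.comp (tangentPair L))
  rw [Metric.tendstoUniformlyOn_iff] at hunif
  rw [Metric.tendsto_nhds]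
  intro ε hε
  set K := κ * ((2 * M + 1) * C ^ 2) with hK
  have hK0 : 0 ≤ K := by positivity
  set η := min 1 (ε / (2 * (K + 1))) with hη
  have hηpos : 0 < η := by positivity
  have hδε : Tendsto (fun n => 3 * (cuni * δ n) * L) atTop (𝓝 0) := by
    simpa using ((hδ0.const_mul cuni).const_mul 3).mul_const L
  filter_upwards [hunif η hηpos, hδε.eventually_lt_const (half_pos hε)] with n h1 h2
  rw [Real.dist_eq, sub_zero]
  refine (abs_bulkEnergy_sub_frozenEnergy_le hL hm (hδ n) hκ (u n) hP hM (η := η)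
    (fun x hx => by rw [← dist_eq_norm, dist_comm]; exact (h1 x hx).le)
    (min_le_left _ _)).trans_lt ?_
  have h3 : κ * (η * (2 * M + 1) * ‖u n‖ ^ 2) ≤ η * K := by
    rw [hK]
    have : ‖u n‖ ^ 2 ≤ C ^ 2 := by
      gcongr
      exact hC n
    calc _ ≤ κ * (η * (2 * M + 1) * C ^ 2) := by gcongr
      _ = _ := by ring
  have h4 : η * K ≤ ε / 2 := by
    calc η * K ≤ ε / (2 * (K + 1)) * (K + 1) := by
          gcongr
          · exact min_le_right _ _
          · linarith
      _ = ε / 2 := by field_simp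
  linarith

end Components

/-! ### Orthonormal frames -/

section Frames

lemma frameMatrix_mem_iff (a b : E3) :
    frameMatrix a b ∈ Matrix.specialOrthogonalGroup (Fin 3) ℝ
      ↔ ‖a‖ = 1 ∧ ‖b‖ = 1 ∧ inner ℝ a b = 0 := by
  have hn : ∀ c : E3, ‖c‖ = 1 ↔ c 0 ^ 2 + c 1 ^ 2 + c 2 ^ 2 = 1 := fun c => by
    rw [← sq_eq_sq₀ (norm_nonneg _) zero_le_one, EuclideanSpace.norm_sq_eq]
    simp [Fin.sum_univ_three]
  have hi : inner ℝ a b = a 0 * b 0 + a 1 * b 1 + a 2 * b 2 := by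
    simp [PiLp.inner_apply, Fin.sum_univ_three, mul_comm]
  rw [hn, hn, hi, Matrix.mem_specialOrthogonalGroup_iff, Matrix.mem_orthogonalGroup_iff']
  constructor
  · rintro ⟨h, -⟩
    have h00 := congrFun (congrFun h 0) 0
    have h11 := congrFun (congrFun h 1) 1
    have h01 := congrFun (congrFun h 0) 1
    simp [frameMatrix, Matrix.mul_apply, Fin.sum_univ_three] at h00 h11 h01
    exact ⟨by linarith, by linarith, by linarith⟩
  · rintro ⟨h1, h2, h3⟩
    have h4 : (a 1 * b 2 - a 2 * b 1) ^ 2 + (a 2 * b 0 - a 0 * b 2) ^ 2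
        + (a 0 * b 1 - a 1 * b 0) ^ 2 = 1 := by
      linear_combination (b 0 ^ 2 + b 1 ^ 2 + b 2 ^ 2) * h1 + h2
        - (a 0 * b 0 + a 1 * b 1 + a 2 * b 2) * h3
    constructor
    · ext i j
      fin_cases i <;> fin_cases j <;>
        simp [frameMatrix, Matrix.mul_apply, Fin.sum_univ_three, cross_apply] <;> linarith
    · simp [frameMatrix, Matrix.det_fin_three, cross_apply]
      linarith

end Frames

/-! ### Partitionings and the lower bound -/

namespace Partition

variable {L : ℝ}

lemma node_mem_Icc (T : Partition L) (j : Fin (T.N + 1)) : T.node j ∈ Icc 0 L := by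
  constructor
  · rw [← T.node_zero]
    exact T.strictMono.monotone (Fin.zero_le j)
  · conv_rhs => rw [← T.node_last]
    exact T.strictMono.monotone (Fin.le_last j)

lemma elemSize_le_meshSize (T : Partition L) (j : Fin T.N) : T.elemSize j ≤ T.meshSize :=
  le_ciSup (finite_range _).bddAbove j

lemma elemSize_pos (T : Partition L) (j : Fin T.N) : 0 < T.elemSize j :=
  sub_pos.2 (T.strictMono j.castSucc_lt_succ)

lemma exists_mem_element (hL : 0 < L) (T : Partition L) {x : ℝ} (hx : x ∈ Icc 0 L) :
    ∃ j : Fin T.N, x ∈ Icc (T.node j.castSucc) (T.node j.succ) := by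
  have key : ∀ k : Fin (T.N + 1), 0 < k → x ≤ T.node k →
      ∃ j : Fin T.N, x ∈ Icc (T.node j.castSucc) (T.node j.succ) := by
    intro k
    induction k using Fin.induction with
    | zero => exact fun h => absurd h (lt_irrefl _)
    | succ j ih =>
      intro _ hxj
      rcases le_total (T.node j.castSucc) x with h | h
      · exact ⟨j, h, hxj⟩
      · rcases (Fin.zero_le j.castSucc).eq_or_lt with h0 | h0
        · refine ⟨j, ?_, hxj⟩
          rw [← h0, T.node_zero]
          exact hx.1
        · exact ih h0 h
  refine key (Fin.last T.N) ?_ (by rw [T.node_last]; exact hx.2)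
  rw [← T.strictMono.lt_iff_lt, T.node_zero, T.node_last]
  exact hL

lemma meshSize_nonneg (hL : 0 < L) (T : Partition L) : 0 ≤ T.meshSize := by
  obtain ⟨j, -⟩ := T.exists_mem_element hL ⟨le_rfl, hL.le⟩
  exact (T.elemSize_pos j).le.trans (T.elemSize_le_meshSize j)

lemma sum_integral_elements (T : Partition L) {f : ℝ → ℝ}
    (hf : ∀ a b, IntervalIntegrable f volume a b) :
    ∑ j : Fin T.N, ∫ x in T.node j.castSucc..T.node j.succ, f x = ∫ x in (0 : ℝ)..L, f x := by
  have h := intervalIntegral.sum_integral_adjacent_intervals (μ := volume) (f := f) (n := T.N)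
    (a := fun k => if h : k < T.N + 1 then T.node ⟨k, h⟩ else L) fun k _ => hf _ _
  simp only [lt_add_iff_pos_left, Nat.zero_lt_succ, dite_true,
    Nat.lt_succ_self] at h
  rw [Finset.sum_range] at h
  have e0 : T.node ⟨0, Nat.succ_pos _⟩ = 0 := T.node_zero
  have e1 : T.node ⟨T.N, Nat.lt_succ_self _⟩ = L := T.node_last
  rw [e0, e1] at h
  rw [← h]
  refine Finset.sum_congr rfl fun j _ => ?_
  rw [dif_pos (Nat.lt_succ_of_lt j.2), dif_pos (Nat.succ_lt_succ j.2)]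
  rfl

end Partition

section LowerBound

variable {L : ℝ}

/-- Unit length at the nodes becomes unit length everywhere in the limit, since the functions are
equi-Hölder and the nodes become dense. -/
lemma norm_evalAt_eq_one_of_nodes (hL : 0 < L) {T : ℕ → Partition L}
    (hh0 : Tendsto (fun n => (T n).meshSize) atTop (𝓝 0))
    {p : ℕ → L2Space L × L2Space L} {q : L2Space L × L2Space L}
    (h : ∀ l : L2Space L × L2Space L →L[ℝ] ℝ, Tendsto (fun n => l (p n)) atTop (𝓝 (l q)))
    (hone : ∀ n j, ‖evalAt L ((T n).node j) (p n)‖ = 1) {x : ℝ} (hx : x ∈ Icc 0 L) :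
    ‖evalAt L x q‖ = 1 := by
  obtain ⟨C, hC0, hC⟩ := exists_norm_le_of_weak_tendsto h
  have h1 : Tendsto (fun n => ‖evalAt L x (p n)‖) atTop (𝓝 ‖evalAt L x q‖) :=
    (tendsto_of_weak_tendsto h (evalAt L x)).norm
  refine tendsto_nhds_unique h1 ?_
  rw [tendsto_iff_norm_sub_tendsto_zero]
  have hlim : Tendsto (fun n => √((T n).meshSize) * C) atTop (𝓝 0) := by
    have := (Real.continuous_sqrt.tendsto 0).comp hh0
    rw [Real.sqrt_zero] at this
    simpa using this.mul_const C
  refine squeeze_zero (fun n => norm_nonneg _) (fun n => ?_) hlim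
  obtain ⟨j, hj⟩ := (T n).exists_mem_element hL hx
  have hsize := (T n).elemSize_le_meshSize j
  rw [← hone n j.castSucc, Real.norm_eq_abs]
  refine (abs_norm_sub_norm_le _ _).trans ?_
  rw [evalAt_sub]
  refine (norm_primitive_sub_le _ _ _).trans ?_
  have hd : |x - (T n).node j.castSucc| ≤ (T n).meshSize := by
    rw [abs_of_nonneg (sub_nonneg.2 hj.1)]
    unfold Partition.elemSize at hsize
    linarith [hj.2]
  gcongr
  exact (norm_snd_le _).trans (hC n)

lemma mem_discreteAdmissible_of_discreteEnergy_le {F : Type*} [NormedAddCommGroup F]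
    [NormedSpace ℝ F] {m : ℝ → ℝ → ℝ} {Lbc : PairSpace L →L[ℝ] F} {lbc : F} {δ ε₁ ε₂ a : ℝ}
    {T : Partition L} {v : PairSpace L} (h : discreteEnergy m Lbc lbc δ ε₁ ε₂ T v ≤ (a : EReal)) :
    v ∈ discreteAdmissible T Lbc lbc ∧ bulkEnergy m δ (1 / (2 * ε₂)) v
      + 1 / (2 * ε₁) * (∫ x in Ioo 0 L, inner ℝ (yDeriv v x) (bFun v x) ^ 2) ≤ a := by
  unfold discreteEnergy at h
  split_ifs at h with hv
  · refine ⟨hv, ?_⟩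
    rw [EReal.coe_le_coe_iff] at h
    unfold bulkEnergy
    linarith
  · simp at h

/-- Orthogonality of tangent and director in the limit, from the vanishing of the penalty
integrals. -/
lemma inner_eq_zero_of_tendsto_integral (hL : 0 < L) {u : ℕ → PairSpace L} {v : PairSpace L}
    (h : ∀ l : PairSpace L →L[ℝ] ℝ, Tendsto (fun n => l (u n)) atTop (𝓝 (l v)))
    (h0 : Tendsto (fun n => ∫ x in Ioo 0 L, inner ℝ (yDeriv (u n) x) (bFun (u n) x) ^ 2)
      atTop (𝓝 0)) :
    ∀ᵐ x ∂(intervalMeasure L), inner ℝ (yDeriv v x) (bFun v x) = 0 := by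
  obtain ⟨C, hC0, hC⟩ := exists_norm_le_of_weak_tendsto fun l => h (l.comp (tangentPair L))
  obtain ⟨D, hD0, hD⟩ := exists_norm_le_of_weak_tendsto fun l => h (l.comp (directorPair L))
  have hcont : ∀ w : PairSpace L, Continuous fun x =>
      inner ℝ (evalAt L x (tangentPair L w)) (evalAt L x (directorPair L w)) ^ 2 := fun w =>
    ((continuous_evalAt _).inner (continuous_evalAt _)).pow 2
  have hae : ∀ w : PairSpace L, (fun x => inner ℝ (yDeriv w x) (bFun w x) ^ 2)
      =ᵐ[intervalMeasure L] fun x =>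
        inner ℝ (evalAt L x (tangentPair L w)) (evalAt L x (directorPair L w)) ^ 2 := fun w => by
    filter_upwards [yDeriv_ae_eq hL w, bFun_ae_eq hL w] with x h1 h2
    rw [h1, h2]
  set K := ‖initialValue L‖ + √L
  have hK : 0 ≤ K := by positivity
  have hlim : Tendsto (fun n => ∫ x in Ioo 0 L, inner ℝ (yDeriv (u n) x) (bFun (u n) x) ^ 2)
      atTop (𝓝 (∫ x in Ioo 0 L,
        inner ℝ (evalAt L x (tangentPair L v)) (evalAt L x (directorPair L v)) ^ 2)) := by
    simp only [integral_congr_ae (hae _)]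
    refine tendsto_integral_of_dominated_convergence (fun _ => (K * C) ^ 2 * (K * D) ^ 2)
      (fun n => (hcont (u n)).aestronglyMeasurable) (integrable_const _) (fun n => ?_) ?_
    · filter_upwards [ae_restrict_mem measurableSet_Ioo] with x hx
      have hx' := Ioo_subset_Icc_self hx
      rw [Real.norm_of_nonneg (sq_nonneg _)]
      have hC' := hC n
      have hD' := hD n
      refine (inner_sq_le
        ((norm_evalAt_le hx' _).trans (mul_le_mul_of_nonneg_left hC' hK))).trans ?_
      gcongr
      exact (norm_evalAt_le hx' _).trans (mul_le_mul_of_nonneg_left hD' hK)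
    · refine Eventually.of_forall fun x => ?_
      exact ((tendsto_of_weak_tendsto h ((evalAt L x).comp (tangentPair L))).inner
        (tendsto_of_weak_tendsto h ((evalAt L x).comp (directorPair L)))).pow 2
  have hzero := tendsto_nhds_unique hlim h0
  rw [integral_eq_zero_iff_of_nonneg (fun x => sq_nonneg _)
    ((hcont v).integrableOn_Icc.mono_set Ioo_subset_Icc_self)] at hzero
  filter_upwards [hzero, hae v] with x h1 h2
  rw [← h2] at h1
  simpa using h1

/-- The compactness and lower bound part: a uniform energy bound passes to weak limits. -/
theorem penalizedEnergy_le_of_discreteEnergy_le {F : Type*} [NormedAddCommGroup F]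
    [NormedSpace ℝ F] (hL : 0 < L) {m : ℝ → ℝ → ℝ} {c₀ c₁ c₂ cuni : ℝ}
    (hm : IsRegularizedModulus m c₀ c₁ c₂ cuni) (Lbc : PairSpace L →L[ℝ] F) (lbc : F)
    {ε₂ : ℝ} (hε₂ : 0 < ε₂) {T : ℕ → Partition L} {δ ε₁ : ℕ → ℝ} (hδ : ∀ n, 0 ≤ δ n)
    (hε₁ : ∀ n, 0 < ε₁ n) (hδ0 : Tendsto δ atTop (𝓝 0)) (hε₁0 : Tendsto ε₁ atTop (𝓝 0))
    (hh0 : Tendsto (fun n => (T n).meshSize) atTop (𝓝 0))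
    {u : ℕ → PairSpace L} {v : PairSpace L}
    (h : ∀ l : PairSpace L →L[ℝ] ℝ, Tendsto (fun n => l (u n)) atTop (𝓝 (l v))) {a : ℝ}
    (ha : ∀ n, discreteEnergy m Lbc lbc (δ n) (ε₁ n) ε₂ (T n) (u n) ≤ (a : EReal)) :
    penalizedEnergy L Lbc lbc ε₂ v ≤ (a : EReal) := by
  have hadm := fun n => (mem_discreteAdmissible_of_discreteEnergy_le (ha n)).1
  have hen := fun n => (mem_discreteAdmissible_of_discreteEnergy_le (ha n)).2
  have hκ : 0 ≤ 1 / (2 * ε₂) := by positivity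
  set κ := 1 / (2 * ε₂) with hκdef
  have hpen : ∀ n, 0 ≤ ∫ x in Ioo 0 L, inner ℝ (yDeriv (u n) x) (bFun (u n) x) ^ 2 := fun n =>
    integral_nonneg fun x => sq_nonneg _
  have hone : ∀ {s : ℝ}, 0 ≤ s → s ^ 2 = 1 → s = 1 := fun h0 h1 =>
    (sq_eq_sq₀ h0 zero_le_one).1 (by rw [h1, one_pow])
  have hnode1 : ∀ n j, ‖evalAt L ((T n).node j) (tangentPair L (u n))‖ = 1 := fun n j => by
    rw [← contRep_yDeriv hL _ ((T n).node_mem_Icc j)]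
    exact hone (norm_nonneg _) ((hadm n).2.1 j).1
  have hnode2 : ∀ n j, ‖evalAt L ((T n).node j) (directorPair L (u n))‖ = 1 := fun n j => by
    rw [← contRep_bFun hL _ ((T n).node_mem_Icc j)]
    exact hone (norm_nonneg _) ((hadm n).2.1 j).2
  have hpen0 : Tendsto (fun n => ∫ x in Ioo 0 L, inner ℝ (yDeriv (u n) x) (bFun (u n) x) ^ 2)
      atTop (𝓝 0) := by
    have : Tendsto (fun n => a * (2 * ε₁ n)) atTop (𝓝 0) := by
      simpa using (hε₁0.const_mul 2).const_mul a
    refine squeeze_zero hpen (fun n => ?_) this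
    have h1 := hen n
    have h2 := bulkEnergy_nonneg hm (hδ n) hκ (u n)
    have h3 := hε₁ n
    rw [← div_le_iff₀ (by positivity)]
    calc _ = 1 / (2 * ε₁ n) * ∫ x in Ioo 0 L, inner ℝ (yDeriv (u n) x) (bFun (u n) x) ^ 2 := by
          ring
      _ ≤ a := by linarith
  have hv : v ∈ admissibleFrames L Lbc lbc := by
    constructor
    · filter_upwards [inner_eq_zero_of_tendsto_integral hL h hpen0, yDeriv_ae_eq hL v,
        bFun_ae_eq hL v, ae_restrict_mem measurableSet_Ioo] with x h1 h2 h3 hx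
      rw [frameMatrix_mem_iff]
      refine ⟨?_, ?_, h1⟩
      · rw [h2]
        exact norm_evalAt_eq_one_of_nodes hL hh0 (fun l => h (l.comp (tangentPair L))) hnode1
          (Ioo_subset_Icc_self hx)
      · rw [h3]
        exact norm_evalAt_eq_one_of_nodes hL hh0 (fun l => h (l.comp (directorPair L))) hnode2
          (Ioo_subset_Icc_self hx)
    · rw [SeparatingDual.eq_iff_forall_dual_eq (R := ℝ)]
      intro g
      refine tendsto_nhds_unique (h (g.comp Lbc)) ?_
      simp only [ContinuousLinearMap.comp_apply, (hadm _).2.2]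
      exact tendsto_const_nhds
  have hP := continuous_evalAt (tangentPair L v)
  have hdiff := tendsto_bulkEnergy_sub_frozenEnergy hL hm hδ hδ0 hκ h
  have hle : frozenEnergy L κ (fun x => evalAt L x (tangentPair L v)) (topPair L v) ≤ a := by
    refine le_of_forall_pos_le_add fun η hη => ?_
    refine le_of_weak_tendsto_of_convexOn (convexOn_frozenEnergy hκ hP)
      (continuous_frozenEnergy hκ hP) (u := fun n => topPair L (u n))
      (fun l => h (l.comp (topPair L))) ?_
    filter_upwards [hdiff.eventually_const_lt (neg_lt_zero.2 hη)] with n hn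
    have h1 := hen n
    have h2 : 0 ≤ 1 / (2 * ε₁ n) * ∫ x in Ioo 0 L, inner ℝ (yDeriv (u n) x) (bFun (u n) x) ^ 2 :=
      mul_nonneg (by have := hε₁ n; positivity) (hpen n)
    linarith
  rw [penalizedEnergy, if_pos hv, EReal.coe_le_coe_iff, ← hκdef]
  rw [frozenEnergy] at hle
  have e1 : ∫ x in Ioo 0 L, inner ℝ (yDeriv v x) (bDeriv v x) ^ 2
      = ∫ x in Ioo 0 L, inner ℝ (evalAt L x (tangentPair L v)) ((topPair L v).2 x) ^ 2 :=
    integral_congr_ae ((yDeriv_ae_eq hL v).mono fun x hx => by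
      simp only [hx]
      rfl)
  rw [e1]
  exact hle

end LowerBound

/-! ### Piecewise polynomials in `L²` -/

section MeshSpace

variable {L : ℝ}

lemma memLp_monomialOn (T : Partition L) (j : Fin T.N) (k : ℕ) (e : E3) :
    MemLp ((Ioc (T.node j.castSucc) (T.node j.succ)).indicator fun x : ℝ => x ^ k • e) 2
      (intervalMeasure L) :=
  (memLp_of_continuous (by fun_prop)).indicator measurableSet_Ioc

/-- The vector-valued monomial `x ↦ xᵏ e` on the `j`-th element, extended by zero. -/
def monomialOn (T : Partition L) (j : Fin T.N) (k : ℕ) : E3 →ₗ[ℝ] L2Space L where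
  toFun e := (memLp_monomialOn T j k e).toLp _
  map_add' e f := by
    rw [← MemLp.toLp_add]
    congr 1
    funext x
    by_cases hx : x ∈ Ioc (T.node j.castSucc) (T.node j.succ) <;> simp [hx]
  map_smul' c e := by
    rw [RingHom.id_apply, ← MemLp.toLp_const_smul]
    congr 1
    funext x
    by_cases hx : x ∈ Ioc (T.node j.castSucc) (T.node j.succ) <;> simp [hx, smul_comm c]

lemma coeFn_monomialOn (T : Partition L) (j : Fin T.N) (k : ℕ) (e : E3) :
    monomialOn T j k e =ᵐ[intervalMeasure L]
      (Ioc (T.node j.castSucc) (T.node j.succ)).indicator fun x : ℝ => x ^ k • e :=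
  (memLp_monomialOn T j k e).coeFn_toLp

/-- The `L²` functions that are polynomials of degree at most `p` on each element of the
partitioning, without continuity conditions at the nodes. -/
def meshSpace (T : Partition L) (p : ℕ) : Submodule ℝ (L2Space L) :=
  ⨆ q : Fin T.N × Fin (p + 1), LinearMap.range (monomialOn T q.1 q.2)

instance (T : Partition L) (p : ℕ) : FiniteDimensional ℝ (meshSpace T p) := by
  unfold meshSpace
  infer_instance

lemma monomialOn_mem_meshSpace (T : Partition L) {p : ℕ} (j : Fin T.N) {k : ℕ} (hk : k ≤ p)
    (e : E3) : monomialOn T j k e ∈ meshSpace T p :=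
  Submodule.mem_iSup_of_mem (p := fun q : Fin T.N × Fin (p + 1) =>
    LinearMap.range (monomialOn T q.1 q.2)) (j, ⟨k, Nat.lt_succ_of_le hk⟩) ⟨e, rfl⟩

lemma Partition.eq_of_mem_of_mem (T : Partition L) {i j : Fin T.N} {x : ℝ}
    (hi : x ∈ Ioc (T.node i.castSucc) (T.node i.succ))
    (hj : x ∈ Ioc (T.node j.castSucc) (T.node j.succ)) : i = j := by
  have h1 : i.castSucc < j.succ := T.strictMono.lt_iff_lt.1 (hi.1.trans_le hj.2)
  have h2 : j.castSucc < i.succ := T.strictMono.lt_iff_lt.1 (hj.1.trans_le hi.2)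
  rw [Fin.lt_def] at h1 h2
  simp only [Fin.val_castSucc, Fin.val_succ] at h1 h2
  exact Fin.ext (by omega)

lemma exists_polynomial_of_mem_meshSpace (T : Partition L) {p : ℕ} {w : L2Space L}
    (hw : w ∈ meshSpace T p) (j : Fin T.N) (i : Fin 3) :
    ∃ q : Polynomial ℝ, q.natDegree ≤ p ∧ ∀ᵐ x ∂(intervalMeasure L),
      x ∈ Ioc (T.node j.castSucc) (T.node j.succ) → w x i = q.eval x := by
  unfold meshSpace at hw
  induction hw using Submodule.iSup_induction' with
  | mem q x hx =>
    obtain ⟨e, rfl⟩ := hx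
    by_cases hq : q.1 = j
    · refine ⟨Polynomial.C (e i) * Polynomial.X ^ (q.2 : ℕ),
        (Polynomial.natDegree_C_mul_X_pow_le _ _).trans (Nat.lt_succ_iff.1 q.2.2), ?_⟩
      filter_upwards [coeFn_monomialOn T q.1 q.2 e] with x hx hxj
      rw [hx, hq, indicator_of_mem hxj, PiLp.smul_apply, smul_eq_mul, mul_comm,
        Polynomial.eval_mul, Polynomial.eval_C, Polynomial.eval_pow, Polynomial.eval_X]
    · refine ⟨0, by simp, ?_⟩
      filter_upwards [coeFn_monomialOn T q.1 q.2 e] with x hx hxj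
      rw [hx, indicator_of_notMem fun h => hq (T.eq_of_mem_of_mem h hxj)]
      simp
  | zero =>
    refine ⟨0, by simp, ?_⟩
    filter_upwards [Lp.coeFn_zero E3 2 (intervalMeasure L)] with x hx _
    rw [hx]
    simp
  | add x y _ _ hx hy =>
    obtain ⟨q, hq, h1⟩ := hx
    obtain ⟨r, hr, h2⟩ := hy
    refine ⟨q + r, (Polynomial.natDegree_add_le _ _).trans (max_le hq hr), ?_⟩
    filter_upwards [h1, h2, Lp.coeFn_add x y] with t ht1 ht2 ht3 ht
    rw [ht3, Pi.add_apply, PiLp.add_apply, ht1 ht, ht2 ht, Polynomial.eval_add]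

lemma coeFn_sum_ae {ι : Type*} (s : Finset ι) (f : ι → L2Space L) :
    (∑ i ∈ s, f i : L2Space L) =ᵐ[intervalMeasure L] fun x => ∑ i ∈ s, f i x := by
  classical
  induction s using Finset.induction_on with
  | empty =>
    simp only [Finset.sum_empty]
    exact Lp.coeFn_zero _ _ _
  | insert a s ha ih =>
    rw [Finset.sum_insert ha]
    filter_upwards [Lp.coeFn_add (f a) (∑ i ∈ s, f i), ih] with x h1 h2
    rw [h1, Pi.add_apply, h2, Finset.sum_insert ha]

lemma Partition.exists_mem_Ioc_element (hL : 0 < L) (T : Partition L) {x : ℝ} (hx : x ∈ Ioo 0 L) :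
    ∃ j : Fin T.N, x ∈ Ioc (T.node j.castSucc) (T.node j.succ) := by
  obtain ⟨j, hj⟩ := T.exists_mem_element hL (Ioo_subset_Icc_self hx)
  rcases hj.1.eq_or_lt with h | h
  · have hj0 : j.castSucc ≠ 0 := fun h0 => by
      rw [h0, T.node_zero] at h
      exact hx.1.ne h
    have hpos : 0 < (j : ℕ) := Nat.pos_of_ne_zero fun h0 => hj0 (Fin.ext h0)
    refine ⟨⟨j - 1, by omega⟩, ?_, ?_⟩
    · rw [← h]
      exact T.strictMono (by rw [Fin.lt_def]; simp; omega)
    · rw [← h]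
      exact T.strictMono.monotone (by rw [Fin.le_def]; simp; omega)
  · exact ⟨j, h, hj.2⟩

/-- A continuous function is approximated by its left nodal values. -/
lemma exists_mem_meshSpace_norm_sub_le (hL : 0 < L) {f : ℝ → E3} (hf : Continuous f) {η : ℝ}
    (hη : 0 < η) : ∃ r > 0, ∀ (T : Partition L) (p : ℕ), T.meshSize < r →
      ∃ s ∈ meshSpace T p, ‖(memLp_of_continuous (L := L) hf).toLp f - s‖ ≤ η := by
  set K := (intervalMeasure L).real univ ^ (2 : ENNReal).toReal⁻¹
  have hK : 0 ≤ K := by positivity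
  have huc := isCompact_Icc.uniformContinuousOn_of_continuous (s := Icc 0 L) hf.continuousOn
  rw [Metric.uniformContinuousOn_iff] at huc
  obtain ⟨r, hr, h⟩ := huc (η / (K + 1)) (by positivity)
  refine ⟨r, hr, fun T p hT => ⟨∑ j : Fin T.N, monomialOn T j 0 (f (T.node j.castSucc)),
    Submodule.sum_mem _ fun j _ => monomialOn_mem_meshSpace T j (Nat.zero_le p) _, ?_⟩⟩
  have hb : ‖(memLp_of_continuous (L := L) hf).toLp f
      - ∑ j : Fin T.N, monomialOn T j 0 (f (T.node j.castSucc))‖ ≤ K * (η / (K + 1)) := by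
    refine Lp.norm_le_of_ae_bound (by positivity) ?_
    have hall : ∀ᵐ x ∂(intervalMeasure L), ∀ j : Fin T.N,
        monomialOn T j 0 (f (T.node j.castSucc)) x
          = (Ioc (T.node j.castSucc) (T.node j.succ)).indicator
              (fun x : ℝ => x ^ 0 • f (T.node j.castSucc)) x :=
      ae_all_iff.2 fun j => coeFn_monomialOn T j 0 _
    filter_upwards [hall, Lp.coeFn_sub ((memLp_of_continuous (L := L) hf).toLp f)
      (∑ j : Fin T.N, monomialOn T j 0 (f (T.node j.castSucc))),
      (memLp_of_continuous (L := L) hf).coeFn_toLp, coeFn_sum_ae (L := L) Finset.univ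
        fun j : Fin T.N => monomialOn T j 0 (f (T.node j.castSucc)),
      ae_restrict_mem measurableSet_Ioo] with x h1 h2 h3 h4 hx
    obtain ⟨j, hj⟩ := T.exists_mem_Ioc_element hL hx
    rw [h2, Pi.sub_apply, h3, h4, Finset.sum_eq_single j, h1 j, indicator_of_mem hj]
    · rw [pow_zero, one_smul, ← dist_eq_norm]
      refine (h x (Ioo_subset_Icc_self hx) _ (T.node_mem_Icc _) ?_).le
      rw [Real.dist_eq, abs_of_pos (sub_pos.2 hj.1)]
      have := T.elemSize_le_meshSize j
      unfold Partition.elemSize at this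
      linarith [hj.2]
    · intro i _ hij
      rw [h1 i, indicator_of_notMem fun hi => hij (T.eq_of_mem_of_mem hi hj)]
    · simp
  refine hb.trans ?_
  rw [mul_div_assoc', div_le_iff₀ (by positivity)]
  nlinarith

/-- The `L²` projections onto piecewise polynomials converge strongly as the mesh is refined. -/
lemma tendsto_starProjection_meshSpace (hL : 0 < L) {T : ℕ → Partition L}
    (hh0 : Tendsto (fun n => (T n).meshSize) atTop (𝓝 0)) (p : ℕ) (w : L2Space L) :
    Tendsto (fun n => (meshSpace (T n) p).starProjection w) atTop (𝓝 w) := by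
  rw [Metric.tendsto_nhds]
  intro ε hε
  obtain ⟨f, hf, hfm⟩ := (Lp.memLp w).exists_boundedContinuous_eLpNorm_sub_le (by simp)
    (ε := ENNReal.ofReal (ε / 3)) (by simpa using hε)
  set g := (memLp_of_continuous (L := L) f.continuous).toLp f with hg
  have hwg : ‖w - g‖ ≤ ε / 3 := by
    have h1 : w = (Lp.memLp w).toLp w := (Lp.toLp_coeFn w (Lp.memLp w)).symm
    rw [h1, hg, ← MemLp.toLp_sub, Lp.norm_toLp]
    exact ENNReal.toReal_le_of_le_ofReal (by positivity) hf
  obtain ⟨r, hr, h⟩ := exists_mem_meshSpace_norm_sub_le hL f.continuous (η := ε / 3) (by positivity)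
  filter_upwards [hh0.eventually_lt_const hr] with n hn
  obtain ⟨s, hs, hgs⟩ := h (T n) p hn
  rw [dist_comm, dist_eq_norm, Submodule.starProjection_minimal]
  calc ⨅ x : meshSpace (T n) p, ‖w - x‖ ≤ ‖w - s‖ :=
        ciInf_le (f := fun x : meshSpace (T n) p => ‖w - x‖)
          ⟨0, by rintro _ ⟨x, rfl⟩; exact norm_nonneg _⟩ ⟨s, hs⟩
    _ = ‖(w - g) + (g - s)‖ := by rw [sub_add_sub_cancel]
    _ ≤ ‖w - g‖ + ‖g - s‖ := norm_add_le _ _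
    _ < ε := by linarith

/-- On every element the projection preserves the moments up to the polynomial degree. -/
lemma integral_pow_mul_sub_starProjection (T : Partition L) {p k : ℕ} (hk : k ≤ p) (w : L2Space L)
    (j : Fin T.N) (i : Fin 3) :
    ∫ x in T.node j.castSucc..T.node j.succ, x ^ k *
      ((Ioo 0 L).indicator ((meshSpace T p).starProjection w - w : L2Space L) x) i = 0 := by
  set d : L2Space L := (meshSpace T p).starProjection w - w with hd
  set I := Ioc (T.node j.castSucc) (T.node j.succ) with hI
  have h0 : inner ℝ (monomialOn T j k (EuclideanSpace.single i 1)) d = 0 := by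
    have := Submodule.starProjection_inner_eq_zero (𝕜 := ℝ) (K := meshSpace T p) w _
      (monomialOn_mem_meshSpace T j hk (EuclideanSpace.single i (1 : ℝ)))
    rw [hd, ← neg_sub, inner_neg_right, real_inner_comm, this, neg_zero]
  rw [L2.inner_def] at h0
  rw [intervalIntegral.integral_of_le (T.strictMono j.castSucc_lt_succ).le,
    ← integral_indicator measurableSet_Ioc]
  rw [← integral_indicator measurableSet_Ioo] at h0
  refine (integral_congr_ae ?_).trans h0
  have := coeFn_monomialOn T j k (EuclideanSpace.single i (1 : ℝ))
  rw [EventuallyEq, ae_restrict_iff' measurableSet_Ioo] at this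
  filter_upwards [this] with x hx
  by_cases hx0 : x ∈ Ioo 0 L
  · by_cases hxI : x ∈ I
    · simp [hx hx0, hx0, ← hI, hxI, inner_smul_left, EuclideanSpace.inner_single_left]
    · simp [hx hx0, hx0, ← hI, hxI]
  · by_cases hxI : x ∈ I <;> simp [hx0, ← hI, hxI]

end MeshSpace

/-! ### Primitives of piecewise polynomials -/

section Splines

variable {L : ℝ}

lemma exists_polynomial_derivative_eq (q : Polynomial ℝ) :
    ∃ r : Polynomial ℝ, r.derivative = q ∧ r.natDegree ≤ q.natDegree + 1 := by
  refine ⟨∑ k ∈ Finset.range (q.natDegree + 1),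
    Polynomial.C (q.coeff k / (k + 1)) * Polynomial.X ^ (k + 1), ?_, ?_⟩
  · conv_rhs => rw [q.as_sum_range_C_mul_X_pow]
    rw [Polynomial.derivative_sum]
    refine Finset.sum_congr rfl fun k _ => ?_
    rw [Polynomial.derivative_C_mul_X_pow, Nat.add_sub_cancel]
    congr 2
    push_cast
    field_simp
  · refine Polynomial.natDegree_sum_le_of_forall_le _ _ fun k hk => ?_
    exact (Polynomial.natDegree_C_mul_X_pow_le _ _).trans (by
      have := Finset.mem_range.1 hk
      omega)

lemma primitive_sub_apply {w : ℝ → E3} (hw : IntegrableOn w (Ioo 0 L)) (x y : ℝ) (i : Fin 3) :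
    primitive L w y i - primitive L w x i = ∫ t in x..y, ((Ioo 0 L).indicator w t) i := by
  rw [← PiLp.sub_apply, primitive_sub_primitive hw]
  exact ((EuclideanSpace.proj i : E3 →L[ℝ] ℝ).intervalIntegral_comp_comm
    (integrable_indicator_of_integrableOn hw).intervalIntegrable).symm

/-- Integrating raises the degree of a piecewise polynomial by one. -/
lemma exists_polynomial_primitive (T : Partition L) {p : ℕ} {w : ℝ → E3}
    (hw : IntegrableOn w (Ioo 0 L)) (C : E3) (j : Fin T.N) (i : Fin 3)
    (h : ∃ q : Polynomial ℝ, q.natDegree ≤ p ∧ ∀ᵐ x ∂(intervalMeasure L),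
      x ∈ Ioc (T.node j.castSucc) (T.node j.succ) → w x i = q.eval x) :
    ∃ q : Polynomial ℝ, q.natDegree ≤ p + 1 ∧
      ∀ x ∈ Icc (T.node j.castSucc) (T.node j.succ), (C + primitive L w x) i = q.eval x := by
  obtain ⟨q, hq, h⟩ := h
  obtain ⟨r, hr, hrd⟩ := exists_polynomial_derivative_eq q
  set a := T.node j.castSucc with ha
  refine ⟨r + Polynomial.C (C i + primitive L w a i - r.eval a), ?_, fun x hx => ?_⟩
  · refine (Polynomial.natDegree_add_le _ _).trans (max_le (hrd.trans (by omega)) ?_)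
    rw [Polynomial.natDegree_C]
    exact Nat.zero_le _
  have h1 := primitive_sub_apply hw a x i
  have h2 : ∫ t in a..x, ((Ioo 0 L).indicator w t) i = ∫ t in a..x, q.eval t := by
    refine intervalIntegral.integral_congr_ae ?_
    rw [ae_restrict_iff' measurableSet_Ioo] at h
    filter_upwards [h, Measure.ae_ne volume L] with t ht htL hta
    rw [uIoc_of_le hx.1] at hta
    have htI : t ∈ Ioo 0 L := ⟨(T.node_mem_Icc _).1.trans_lt hta.1,
      lt_of_le_of_ne (hta.2.trans (hx.2.trans (T.node_mem_Icc _).2)) htL⟩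
    rw [indicator_of_mem htI]
    exact ht htI ⟨hta.1, hta.2.trans hx.2⟩
  have h3 : ∫ t in a..x, q.eval t = r.eval x - r.eval a := by
    refine intervalIntegral.integral_eq_sub_of_hasDerivAt (f := fun t => r.eval t) (fun t _ => ?_)
      (q.continuous.intervalIntegrable _ _)
    rw [← hr]
    exact r.hasDerivAt t
  rw [PiLp.add_apply, Polynomial.eval_add, Polynomial.eval_C]
  linarith

lemma primitive_eq_integral {P : ℝ → E3} {x : ℝ} (hx : x ∈ Icc 0 L) :
    primitive L P x = ∫ t in (0 : ℝ)..x, P t := by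
  refine intervalIntegral.integral_congr_ae ?_
  filter_upwards [Measure.ae_ne volume L] with t htL ht
  rw [uIoc_of_le hx.1] at ht
  exact indicator_of_mem (show t ∈ Ioo 0 L from ⟨ht.1, lt_of_le_of_ne (ht.2.trans hx.2) htL⟩) _

lemma contDiffOn_primitive {P : ℝ → E3} (hP : Continuous P) (C : E3) :
    ContDiffOn ℝ 1 (fun x => C + primitive L P x) (Ioo 0 L) := by
  have h1 : ∀ x, HasDerivAt (fun x => C + ∫ t in (0 : ℝ)..x, P t) (P x) x := fun x =>
    (hP.integral_hasStrictDerivAt 0 x).hasDerivAt.const_add C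
  have h2 : ContDiff ℝ 1 fun x => C + ∫ t in (0 : ℝ)..x, P t := by
    rw [contDiff_one_iff_deriv]
    refine ⟨fun x => (h1 x).differentiableAt, ?_⟩
    rw [funext fun x => (h1 x).deriv]
    exact hP
  exact h2.contDiffOn.congr fun x hx => by rw [primitive_eq_integral (Ioo_subset_Icc_self hx)]

/-- Pairs with piecewise affine `y''` and piecewise constant `b'` belong to the discrete space. -/
lemma mem_discreteSpace (hL : 0 < L) (T : Partition L) {v : PairSpace L}
    (hy : yComp L 2 v ∈ meshSpace T 1) (hb : bComp L 1 v ∈ meshSpace T 0) :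
    v ∈ discreteSpace T := by
  constructor
  · refine ⟨fun x => evalAt L x (yPair L v), fun i => ⟨?_, fun j => ?_⟩,
      (hasWeakDeriv_yPair v).ae_eq_evalAt hL⟩
    · have hae : (yPair L v).2 =ᵐ[intervalMeasure L] fun x => evalAt L x (tangentPair L v) :=
        yDeriv_ae_eq hL v
      have := contDiffOn_primitive (L := L) (continuous_evalAt (tangentPair L v))
        (initialValue L (yPair L v))
      rw [← primitive_congr hae] at this
      exact (EuclideanSpace.proj i : E3 →L[ℝ] ℝ).contDiff.comp_contDiffOn this
    · refine exists_polynomial_primitive T (yPair L v).2.integrableOn _ j i ?_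
      obtain ⟨q, hq, h⟩ := exists_polynomial_primitive T (tangentPair L v).2.integrableOn
        (initialValue L (tangentPair L v)) j i (exists_polynomial_of_mem_meshSpace T hy j i)
      refine ⟨q, hq, ?_⟩
      filter_upwards [yDeriv_ae_eq hL v] with x hx hxj
      rw [← h x (Ioc_subset_Icc_self hxj)]
      exact congrArg (fun z : E3 => z i) hx
  · refine ⟨fun x => evalAt L x (directorPair L v), fun i => ⟨?_, fun j => ?_⟩,
      (hasWeakDeriv_directorPair v).ae_eq_evalAt hL⟩
    · rw [Nat.cast_zero, contDiffOn_zero]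
      exact ((EuclideanSpace.proj i : E3 →L[ℝ] ℝ).continuous.comp
        (continuous_evalAt (directorPair L v))).continuousOn
    · exact exists_polynomial_primitive T (directorPair L v).2.integrableOn _ j i
        (exists_polynomial_of_mem_meshSpace T hb j i)

end Splines

/-! ### Nodal interpolation -/

section Interpolation

variable {L : ℝ}

lemma hasWeakDeriv_primitiveL (hL : 0 < L) (w : L2Space L) : HasWeakDeriv L (primitiveL L w) w := by
  have := hasWeakDeriv_const_add_primitive hL w.integrableOn 0
  simp only [zero_add] at this
  exact this.congr_left (coeFn_primitiveL w).symm

/-- The pair `(y, b)` with `y'' = w`, `b' = z` and vanishing initial values of `y`, `y'` and `b`. -/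
def extend (hL : 0 < L) (p : L2Space L × L2Space L) : PairSpace L :=
  (⟨WithLp.toLp 2 ![primitiveL L (primitiveL L p.1), primitiveL L p.1, p.1], by
      intro j
      fin_cases j
      · exact hasWeakDeriv_primitiveL hL _
      · exact hasWeakDeriv_primitiveL hL _⟩,
    ⟨WithLp.toLp 2 ![primitiveL L p.2, p.2], by
      intro j
      fin_cases j
      exact hasWeakDeriv_primitiveL hL _⟩)

lemma continuous_extend (hL : 0 < L) : Continuous (extend hL) := by
  refine Continuous.prodMk (Continuous.subtype_mk ?_ _) (Continuous.subtype_mk ?_ _)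
  · refine (PiLp.continuous_toLp 2 _).comp (continuous_pi fun j => ?_)
    fin_cases j
    · exact (primitiveL L).continuous.comp ((primitiveL L).continuous.comp continuous_fst)
    · exact (primitiveL L).continuous.comp continuous_fst
    · exact continuous_fst
  · refine (PiLp.continuous_toLp 2 _).comp (continuous_pi fun j => ?_)
    fin_cases j
    · exact (primitiveL L).continuous.comp continuous_snd
    · exact continuous_snd

lemma extend_zero (hL : 0 < L) : extend hL (0 : L2Space L × L2Space L) = 0 := by
  refine Prod.ext (Subtype.ext ?_) (Subtype.ext ?_)
  · ext1 j
    fin_cases j <;> simp [extend]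
  · ext1 j
    fin_cases j <;> simp [extend]

lemma evalAt_primitiveL (hL : 0 < L) (w : L2Space L) (x : ℝ) :
    evalAt L x (primitiveL L w, w) = primitive L w x := by
  rw [evalAt_apply, initialValue_eq (C := 0) hL, zero_add]
  filter_upwards [coeFn_primitiveL w] with x hx
  rw [hx, zero_add]

lemma evalAt_yPair_extend (hL : 0 < L) (p : L2Space L × L2Space L) (x : ℝ) :
    evalAt L x (yPair L (extend hL p)) = primitive L (primitive L p.1) x := by
  rw [← primitive_congr (coeFn_primitiveL p.1)]
  exact evalAt_primitiveL hL (primitiveL L p.1) x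

lemma evalAt_tangentPair_extend (hL : 0 < L) (p : L2Space L × L2Space L) (x : ℝ) :
    evalAt L x (tangentPair L (extend hL p)) = primitive L p.1 x := evalAt_primitiveL hL p.1 x

lemma evalAt_directorPair_extend (hL : 0 < L) (p : L2Space L × L2Space L) (x : ℝ) :
    evalAt L x (directorPair L (extend hL p)) = primitive L p.2 x := evalAt_primitiveL hL p.2 x

/-- Integration by parts against the identity. -/
lemma integral_integral_eq {g : ℝ → ℝ} (hg : Integrable g) (a b : ℝ) :
    ∫ x in a..b, ∫ t in a..x, g t = b * (∫ t in a..b, g t) - ∫ x in a..b, x * g x := by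
  have h1 := (hg.intervalIntegrable (a := a) (b := b)
    ).absolutelyContinuousOnInterval_intervalIntegral (c := a) (by simp)
  have h2 : AbsolutelyContinuousOnInterval (fun x : ℝ => x) a b :=
    LipschitzWith.id.lipschitzOnWith.absolutelyContinuousOnInterval
  have h3 := h2.integral_mul_deriv_eq_deriv_mul h1
  have h4 : ∫ x in a..b, x * deriv (fun x => ∫ t in a..x, g t) x = ∫ x in a..b, x * g x := by
    refine intervalIntegral.integral_congr_ae ?_
    filter_upwards [LocallyIntegrable.ae_hasDerivAt_integral hg.locallyIntegrable] with x hx _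
    rw [(hx a).deriv]
  rw [h4] at h3
  simp only [intervalIntegral.integral_same, mul_zero, sub_zero, deriv_id'', one_mul] at h3
  linarith

variable {p : ℕ} (T : Partition L) (w : L2Space L)

/-- Replacing a derivative by its projection onto piecewise polynomials does not change the nodal
values of the primitive. -/
lemma primitive_starProjection_sub_node (k : Fin (T.N + 1)) :
    primitive L ((meshSpace T p).starProjection w - w : L2Space L) (T.node k) = 0 := by
  induction k using Fin.induction with
  | zero => rw [T.node_zero, primitive_zero]
  | succ j ih =>
    ext i
    have h1 := integral_pow_mul_sub_starProjection T (Nat.zero_le p) w j i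
    simp only [pow_zero, one_mul] at h1
    rw [← primitive_sub_apply (L2Space.integrableOn _), ih] at h1
    simpa using h1

/-- If the derivative is projected onto piecewise affine functions, the nodal values of the second
primitive do not change either: this is cubic Hermite interpolation. -/
lemma primitive_primitive_starProjection_sub_node (hp : 1 ≤ p) (k : Fin (T.N + 1)) :
    primitive L (primitive L ((meshSpace T p).starProjection w - w : L2Space L))
      (T.node k) = 0 := by
  set d : L2Space L := (meshSpace T p).starProjection w - w with hd
  have hdc : Continuous (primitive L d) := continuous_primitive d.integrableOn
  have hdi : IntegrableOn (primitive L d) (Ioo 0 L) :=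
    hdc.integrableOn_Icc.mono_set Ioo_subset_Icc_self
  induction k using Fin.induction with
  | zero => rw [T.node_zero, primitive_zero]
  | succ j ih =>
    ext i
    have hlt := T.strictMono j.castSucc_lt_succ
    set a := T.node j.castSucc with ha
    set b := T.node j.succ with hb
    have ha0 : primitive L d a = 0 := primitive_starProjection_sub_node T w j.castSucc
    have h0 := integral_pow_mul_sub_starProjection T (Nat.zero_le p) w j i
    have h1 := integral_pow_mul_sub_starProjection T hp w j i
    simp only [pow_zero, pow_one, one_mul, ← hd, ← ha, ← hb] at h0 h1
    have h2 := primitive_sub_apply hdi a b i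
    rw [ih] at h2
    have hgi : Integrable fun x => ((Ioo 0 L).indicator d x) i :=
      (EuclideanSpace.proj i : E3 →L[ℝ] ℝ).integrable_comp
        (integrable_indicator_of_integrableOn d.integrableOn)
    have h3 : ∫ t in a..b, ((Ioo 0 L).indicator (primitive L d) t) i
        = ∫ x in a..b, ∫ t in a..x, ((Ioo 0 L).indicator d t) i := by
      refine intervalIntegral.integral_congr_ae ?_
      filter_upwards [Measure.ae_ne volume L] with t htL ht
      rw [uIoc_of_le hlt.le] at ht
      have htI : t ∈ Ioo 0 L := ⟨(T.node_mem_Icc _).1.trans_lt ht.1,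
        lt_of_le_of_ne (ht.2.trans (T.node_mem_Icc _).2) htL⟩
      rw [indicator_of_mem htI, ← primitive_sub_apply d.integrableOn, ha0]
      simp
    rw [h3, integral_integral_eq hgi, h0, h1] at h2
    simpa using h2

end Interpolation

/-! ### Recovery sequences -/

section Recovery

variable {L : ℝ}

/-- The discrete pair with `y''` and `b'` replaced by their projections onto piecewise affine and
piecewise constant functions: the cubic Hermite interpolant of `y` and the piecewise affine
interpolant of `b`. -/
def interpolant (hL : 0 < L) (T : Partition L) (v : PairSpace L) : PairSpace L :=
  v + extend hL ((meshSpace T 1).starProjection (yComp L 2 v) - yComp L 2 v,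
    (meshSpace T 0).starProjection (bComp L 1 v) - bComp L 1 v)

lemma tendsto_interpolant (hL : 0 < L) {T : ℕ → Partition L}
    (hh0 : Tendsto (fun n => (T n).meshSize) atTop (𝓝 0)) (v : PairSpace L) :
    Tendsto (fun n => interpolant hL (T n) v) atTop (𝓝 v) := by
  have h1 := (tendsto_starProjection_meshSpace hL hh0 1 (yComp L 2 v)).sub_const (yComp L 2 v)
  have h2 := (tendsto_starProjection_meshSpace hL hh0 0 (bComp L 1 v)).sub_const (bComp L 1 v)
  rw [sub_self] at h1 h2
  have h3 := ((continuous_extend hL).tendsto 0).comp (h1.prodMk_nhds h2)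
  rw [extend_zero] at h3
  simpa [interpolant] using h3.const_add v

lemma interpolant_mem_discreteSpace (hL : 0 < L) (T : Partition L) (v : PairSpace L) :
    interpolant hL T v ∈ discreteSpace T := by
  refine mem_discreteSpace hL T ?_ ?_
  · rw [interpolant, map_add]
    change yComp L 2 v + ((meshSpace T 1).starProjection (yComp L 2 v) - yComp L 2 v) ∈ _
    rw [add_sub_cancel]
    exact Submodule.starProjection_apply_mem _ _
  · rw [interpolant, map_add]
    change bComp L 1 v + ((meshSpace T 0).starProjection (bComp L 1 v) - bComp L 1 v) ∈ _
    rw [add_sub_cancel]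
    exact Submodule.starProjection_apply_mem _ _

lemma evalAt_yPair_interpolant (hL : 0 < L) (T : Partition L) (v : PairSpace L)
    (k : Fin (T.N + 1)) :
    evalAt L (T.node k) (yPair L (interpolant hL T v)) = evalAt L (T.node k) (yPair L v) := by
  rw [interpolant, map_add, map_add, evalAt_yPair_extend,
    primitive_primitive_starProjection_sub_node T _ le_rfl, add_zero]

lemma evalAt_tangentPair_interpolant (hL : 0 < L) (T : Partition L) (v : PairSpace L)
    (k : Fin (T.N + 1)) :
    evalAt L (T.node k) (tangentPair L (interpolant hL T v))
      = evalAt L (T.node k) (tangentPair L v) := by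
  rw [interpolant, map_add, map_add, evalAt_tangentPair_extend,
    primitive_starProjection_sub_node, add_zero]

lemma evalAt_directorPair_interpolant (hL : 0 < L) (T : Partition L) (v : PairSpace L)
    (k : Fin (T.N + 1)) :
    evalAt L (T.node k) (directorPair L (interpolant hL T v))
      = evalAt L (T.node k) (directorPair L v) := by
  rw [interpolant, map_add, map_add, evalAt_directorPair_extend,
    primitive_starProjection_sub_node, add_zero]

lemma boundaryValues_interpolant (hL : 0 < L) (T : Partition L) (v : PairSpace L) :
    boundaryValues (interpolant hL T v) = boundaryValues v := by
  have h0 : (0 : ℝ) ∈ Icc 0 L := ⟨le_rfl, hL.le⟩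
  have h1 : L ∈ Icc 0 L := ⟨hL.le, le_rfl⟩
  have e1 := evalAt_yPair_interpolant hL T v
  have e2 := evalAt_tangentPair_interpolant hL T v
  have e3 := evalAt_directorPair_interpolant hL T v
  have a1 := e1 0
  have a2 := e2 0
  have a3 := e3 0
  have b1 := e1 (Fin.last _)
  have b2 := e2 (Fin.last _)
  have b3 := e3 (Fin.last _)
  rw [T.node_zero] at a1 a2 a3
  rw [T.node_last] at b1 b2 b3
  simp only [boundaryValues, contRep_yFun hL _ h0, contRep_yFun hL _ h1, contRep_yDeriv hL _ h0,
    contRep_yDeriv hL _ h1, contRep_bFun hL _ h0, contRep_bFun hL _ h1, a1, a2, a3, b1, b2, b3]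

lemma eqOn_Icc_of_ae_eq (hL : 0 < L) {f g : ℝ → ℝ} (hf : Continuous f) (hg : Continuous g)
    (h : f =ᵐ[intervalMeasure L] g) {x : ℝ} (hx : x ∈ Icc 0 L) : f x = g x := by
  refine Measure.eqOn_Icc_of_ae_eq volume hL.ne ?_ hf.continuousOn hg.continuousOn hx
  rwa [← restrict_Ioo_eq_restrict_Icc]

/-- For admissible frames the continuous representatives are orthonormal at every point. -/
lemma frame_of_mem_admissibleFrames {F : Type*} [NormedAddCommGroup F] [NormedSpace ℝ F]
    (hL : 0 < L) {Lbc : PairSpace L →L[ℝ] F} {lbc : F} {v : PairSpace L}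
    (hv : v ∈ admissibleFrames L Lbc lbc) {x : ℝ} (hx : x ∈ Icc 0 L) :
    ‖evalAt L x (tangentPair L v)‖ = 1 ∧ ‖evalAt L x (directorPair L v)‖ = 1 ∧
      inner ℝ (evalAt L x (tangentPair L v)) (evalAt L x (directorPair L v)) = 0 := by
  have hP := continuous_evalAt (tangentPair L v)
  have hB := continuous_evalAt (directorPair L v)
  have h : ∀ᵐ x ∂(intervalMeasure L), ‖evalAt L x (tangentPair L v)‖ = 1 ∧
      ‖evalAt L x (directorPair L v)‖ = 1 ∧
      inner ℝ (evalAt L x (tangentPair L v)) (evalAt L x (directorPair L v)) = 0 := by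
    filter_upwards [hv.1, yDeriv_ae_eq hL v, bFun_ae_eq hL v] with x h1 h2 h3
    rwa [frameMatrix_mem_iff, h2, h3] at h1
  exact ⟨eqOn_Icc_of_ae_eq hL hP.norm continuous_const (h.mono fun x h => h.1) hx,
    eqOn_Icc_of_ae_eq hL hB.norm continuous_const (h.mono fun x h => h.2.1) hx,
    eqOn_Icc_of_ae_eq hL (hP.inner hB) continuous_const (h.mono fun x h => h.2.2) hx⟩

lemma interpolant_mem_discreteAdmissible {F : Type*} [NormedAddCommGroup F] [NormedSpace ℝ F]
    (hL : 0 < L) {Lbc : PairSpace L →L[ℝ] F}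
    (hLbc : ∀ u v : PairSpace L, boundaryValues u = boundaryValues v → Lbc u = Lbc v) {lbc : F}
    {v : PairSpace L} (hv : v ∈ admissibleFrames L Lbc lbc) (T : Partition L) :
    interpolant hL T v ∈ discreteAdmissible T Lbc lbc := by
  refine ⟨interpolant_mem_discreteSpace hL T v, fun j => ?_,
    (hLbc _ _ (boundaryValues_interpolant hL T v)).trans hv.2⟩
  have hj := T.node_mem_Icc j
  obtain ⟨h1, h2, -⟩ := frame_of_mem_admissibleFrames hL hv hj
  rw [contRep_yDeriv hL _ hj, contRep_bFun hL _ hj, evalAt_tangentPair_interpolant,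
    evalAt_directorPair_interpolant, h1, h2]
  simp

/-- If `y' · b` vanishes at the nodes, its square integral is of order `h²`. -/
lemma integral_inner_sq_le_of_nodes (hL : 0 < L) (T : Partition L) (p q : L2Space L × L2Space L)
    {M : ℝ} (hp : ∀ x ∈ Icc 0 L, ‖evalAt L x p‖ ≤ M) (hq : ∀ x ∈ Icc 0 L, ‖evalAt L x q‖ ≤ M)
    (hnode : ∀ k, inner ℝ (evalAt L (T.node k) p) (evalAt L (T.node k) q) = 0) :
    ∫ x in Ioo 0 L, inner ℝ (evalAt L x p) (evalAt L x q) ^ 2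
      ≤ 2 * M ^ 2 * T.meshSize ^ 2 * (‖p.2‖ ^ 2 + ‖q.2‖ ^ 2) := by
  have hM : 0 ≤ M := (norm_nonneg _).trans (hp 0 ⟨le_rfl, hL.le⟩)
  have hh := T.meshSize_nonneg hL
  set h := T.meshSize
  set G : ℝ → ℝ := fun t => ‖(Ioo 0 L).indicator p.2 t‖ ^ 2 + ‖(Ioo 0 L).indicator q.2 t‖ ^ 2
    with hG
  have hGp := integrable_norm_indicator_sq p.2
  have hGq := integrable_norm_indicator_sq q.2
  have hGi : Integrable G := hGp.add hGq
  have hG0 : ∀ t, 0 ≤ G t := fun t => by simp only [hG]; positivity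
  have hfc : Continuous fun x => inner ℝ (evalAt L x p) (evalAt L x q) ^ 2 :=
    ((continuous_evalAt p).inner (continuous_evalAt q)).pow 2
  have helem : ∀ j : Fin T.N, ∫ x in T.node j.castSucc..T.node j.succ,
      inner ℝ (evalAt L x p) (evalAt L x q) ^ 2
        ≤ 2 * M ^ 2 * h ^ 2 * ∫ t in T.node j.castSucc..T.node j.succ, G t := by
    intro j
    have hsize := T.elemSize_le_meshSize j
    have hlt := T.strictMono j.castSucc_lt_succ
    unfold Partition.elemSize at hsize
    have ha := T.node_mem_Icc j.castSucc
    have hb := T.node_mem_Icc j.succ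
    have hna := hnode j.castSucc
    set a := T.node j.castSucc
    set b := T.node j.succ
    have hGab : 0 ≤ ∫ t in a..b, G t := intervalIntegral.integral_nonneg hlt.le fun t _ => hG0 t
    have hpt : ∀ x ∈ Icc a b, inner ℝ (evalAt L x p) (evalAt L x q) ^ 2
        ≤ 2 * M ^ 2 * h * ∫ t in a..b, G t := by
      intro x hx
      have hx' : x ∈ Icc 0 L := ⟨ha.1.trans hx.1, hx.2.trans hb.2⟩
      -- subtract the value zero at the left node
      have hsplit : inner ℝ (evalAt L x p) (evalAt L x q)
          = inner ℝ (primitive L p.2 x - primitive L p.2 a) (evalAt L x q)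
            + inner ℝ (evalAt L a p) (primitive L q.2 x - primitive L q.2 a) := by
        rw [← evalAt_sub, ← evalAt_sub, inner_sub_left, inner_sub_right, hna]
        ring
      have h1 : inner ℝ (primitive L p.2 x - primitive L p.2 a) (evalAt L x q) ^ 2
          ≤ M ^ 2 * ‖primitive L p.2 x - primitive L p.2 a‖ ^ 2 := by
        rw [real_inner_comm]
        exact inner_sq_le (hq x hx')
      have h2 : inner ℝ (evalAt L a p) (primitive L q.2 x - primitive L q.2 a) ^ 2
          ≤ M ^ 2 * ‖primitive L q.2 x - primitive L q.2 a‖ ^ 2 := inner_sq_le (hp a ha)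
      have h3 := norm_primitive_sub_sq_le_integral p.2 hx.1
      have h4 := norm_primitive_sub_sq_le_integral q.2 hx.1
      have h5 : (∫ t in a..x, ‖(Ioo 0 L).indicator p.2 t‖ ^ 2)
          + (∫ t in a..x, ‖(Ioo 0 L).indicator q.2 t‖ ^ 2) ≤ ∫ t in a..b, G t := by
        rw [← intervalIntegral.integral_add hGp.intervalIntegrable hGq.intervalIntegrable]
        exact intervalIntegral.integral_mono_interval le_rfl hx.1 hx.2
          (Eventually.of_forall hG0) hGi.intervalIntegrable
      have h6 : ‖primitive L p.2 x - primitive L p.2 a‖ ^ 2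
          + ‖primitive L q.2 x - primitive L q.2 a‖ ^ 2 ≤ h * ∫ t in a..b, G t := by
        calc _ ≤ (x - a) * ((∫ t in a..x, ‖(Ioo 0 L).indicator p.2 t‖ ^ 2)
              + (∫ t in a..x, ‖(Ioo 0 L).indicator q.2 t‖ ^ 2)) := by linarith
          _ ≤ (x - a) * ∫ t in a..b, G t := mul_le_mul_of_nonneg_left h5 (sub_nonneg.2 hx.1)
          _ ≤ h * ∫ t in a..b, G t :=
            mul_le_mul_of_nonneg_right (by linarith [hx.2]) hGab
      have h7 := mul_le_mul_of_nonneg_left h6 (sq_nonneg M)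
      rw [hsplit]
      refine (add_sq_le (a := _) (b := _)).trans ?_
      nlinarith [h1, h2, h7]
    calc ∫ x in a..b, inner ℝ (evalAt L x p) (evalAt L x q) ^ 2
        ≤ ∫ _ in a..b, 2 * M ^ 2 * h * ∫ t in a..b, G t :=
          intervalIntegral.integral_mono_on hlt.le (hfc.intervalIntegrable _ _) (by simp) hpt
      _ = (b - a) * (2 * M ^ 2 * h * ∫ t in a..b, G t) := by
          rw [intervalIntegral.integral_const, smul_eq_mul]
      _ ≤ h * (2 * M ^ 2 * h * ∫ t in a..b, G t) :=
          mul_le_mul_of_nonneg_right hsize (by positivity)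
      _ = _ := by ring
  have hint : ∀ w : L2Space L, ∫ t in (0 : ℝ)..L, ‖(Ioo 0 L).indicator w t‖ ^ 2 = ‖w‖ ^ 2 := by
    intro w
    rw [w.norm_sq_eq, intervalIntegral.integral_of_le hL.le, integral_Ioc_eq_integral_Ioo]
    exact setIntegral_congr_fun measurableSet_Ioo fun x hx => by simp only [indicator_of_mem hx]
  have hGtot : ∫ t in (0 : ℝ)..L, G t = ‖p.2‖ ^ 2 + ‖q.2‖ ^ 2 := by
    rw [hG, intervalIntegral.integral_add hGp.intervalIntegrable hGq.intervalIntegrable, hint, hint]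
  rw [← hGtot, ← integral_Ioc_eq_integral_Ioo, ← intervalIntegral.integral_of_le hL.le,
    ← T.sum_integral_elements fun a b => hfc.intervalIntegrable a b,
    ← T.sum_integral_elements fun a b => hGi.intervalIntegrable, Finset.mul_sum]
  exact Finset.sum_le_sum fun j _ => helem j

/-- The rescaled penalty of the interpolants vanishes in the limit if `h² / ε₁ → 0`. -/
lemma tendsto_penalty_interpolant {F : Type*} [NormedAddCommGroup F] [NormedSpace ℝ F]
    (hL : 0 < L) {Lbc : PairSpace L →L[ℝ] F} {lbc : F} {v : PairSpace L}
    (hv : v ∈ admissibleFrames L Lbc lbc) {T : ℕ → Partition L} {ε₁ : ℕ → ℝ}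
    (hε₁ : ∀ n, 0 < ε₁ n) (hh0 : Tendsto (fun n => (T n).meshSize) atTop (𝓝 0))
    (hrel : Tendsto (fun n => (T n).meshSize ^ 2 / ε₁ n) atTop (𝓝 0)) :
    Tendsto (fun n => 1 / (2 * ε₁ n) * ∫ x in Ioo 0 L,
      inner ℝ (yDeriv (interpolant hL (T n) v) x) (bFun (interpolant hL (T n) v) x) ^ 2)
      atTop (𝓝 0) := by
  have hu := tendsto_interpolant hL hh0 v
  obtain ⟨C, hC⟩ := (((tangentPair L).continuous.tendsto v).comp hu).norm.bddAbove_range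
  obtain ⟨D, hD⟩ := (((directorPair L).continuous.tendsto v).comp hu).norm.bddAbove_range
  have hC' : ∀ n, ‖tangentPair L (interpolant hL (T n) v)‖ ≤ max C D := fun n =>
    (hC ⟨n, rfl⟩).trans (le_max_left _ _)
  have hD' : ∀ n, ‖directorPair L (interpolant hL (T n) v)‖ ≤ max C D := fun n =>
    (hD ⟨n, rfl⟩).trans (le_max_right _ _)
  set K := max C D
  set A := ‖initialValue L‖ + √L
  have hA : 0 ≤ A := by positivity
  have hK : 0 ≤ K := (norm_nonneg _).trans (hC' 0)
  have hlim : Tendsto (fun n => 2 * (A * K) ^ 2 * K ^ 2 * ((T n).meshSize ^ 2 / ε₁ n))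
      atTop (𝓝 0) := by
    simpa using hrel.const_mul (2 * (A * K) ^ 2 * K ^ 2)
  refine squeeze_zero (fun n => mul_nonneg (by have := hε₁ n; positivity)
    (integral_nonneg fun x => sq_nonneg _)) (fun n => ?_) hlim
  set u := interpolant hL (T n) v with hudef
  have hε := hε₁ n
  have h1 : ∫ x in Ioo 0 L, inner ℝ (yDeriv u x) (bFun u x) ^ 2
      = ∫ x in Ioo 0 L,
        inner ℝ (evalAt L x (tangentPair L u)) (evalAt L x (directorPair L u)) ^ 2 := by
    refine integral_congr_ae ?_
    filter_upwards [yDeriv_ae_eq hL u, bFun_ae_eq hL u] with x h1 h2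
    rw [h1, h2]
  have h2 := integral_inner_sq_le_of_nodes hL (T n) (tangentPair L u) (directorPair L u)
    (M := A * K) (fun x hx => (norm_evalAt_le hx _).trans (mul_le_mul_of_nonneg_left (hC' n) hA))
    (fun x hx => (norm_evalAt_le hx _).trans (mul_le_mul_of_nonneg_left (hD' n) hA)) (fun k => by
      rw [hudef, evalAt_tangentPair_interpolant, evalAt_directorPair_interpolant]
      exact (frame_of_mem_admissibleFrames hL hv ((T n).node_mem_Icc k)).2.2)
  have h3 : ‖(tangentPair L u).2‖ ^ 2 + ‖(directorPair L u).2‖ ^ 2 ≤ 2 * K ^ 2 := by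
    have e1 : ‖(tangentPair L u).2‖ ^ 2 ≤ K ^ 2 :=
      pow_le_pow_left₀ (norm_nonneg _) ((norm_snd_le _).trans (hC' n)) 2
    have e2 : ‖(directorPair L u).2‖ ^ 2 ≤ K ^ 2 :=
      pow_le_pow_left₀ (norm_nonneg _) ((norm_snd_le _).trans (hD' n)) 2
    linarith
  rw [h1]
  calc _ ≤ 1 / (2 * ε₁ n) * (2 * (A * K) ^ 2 * (T n).meshSize ^ 2 * (2 * K ^ 2)) := by
        gcongr
        exact h2.trans (by gcongr)
    _ = _ := by
        field_simp

/-- The discrete energies of the interpolants of an admissible pair converge. -/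
lemma tendsto_discreteEnergy_interpolant {F : Type*} [NormedAddCommGroup F] [NormedSpace ℝ F]
    (hL : 0 < L) {m : ℝ → ℝ → ℝ} {c₀ c₁ c₂ cuni : ℝ}
    (hm : IsRegularizedModulus m c₀ c₁ c₂ cuni) {Lbc : PairSpace L →L[ℝ] F}
    (hLbc : ∀ u v : PairSpace L, boundaryValues u = boundaryValues v → Lbc u = Lbc v) {lbc : F}
    {ε₂ : ℝ} (hε₂ : 0 < ε₂) {T : ℕ → Partition L} {δ ε₁ : ℕ → ℝ} (hδ : ∀ n, 0 ≤ δ n)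
    (hε₁ : ∀ n, 0 < ε₁ n) (hδ0 : Tendsto δ atTop (𝓝 0))
    (hh0 : Tendsto (fun n => (T n).meshSize) atTop (𝓝 0))
    (hrel : Tendsto (fun n => (T n).meshSize ^ 2 / ε₁ n) atTop (𝓝 0))
    {v : PairSpace L} (hv : v ∈ admissibleFrames L Lbc lbc) :
    Tendsto (fun n => discreteEnergy m Lbc lbc (δ n) (ε₁ n) ε₂ (T n) (interpolant hL (T n) v))
      atTop (𝓝 (penalizedEnergy L Lbc lbc ε₂ v)) := by
  have hκ : 0 ≤ 1 / (2 * ε₂) := by positivity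
  have hu := tendsto_interpolant hL hh0 v
  have hP := continuous_evalAt (tangentPair L v)
  have h1 := tendsto_bulkEnergy_sub_frozenEnergy hL hm hδ hδ0 hκ
    (fun l => (l.continuous.tendsto v).comp hu)
  have h2 := (((continuous_frozenEnergy hκ hP).comp (topPair L).continuous).tendsto v).comp hu
  have h3 := tendsto_penalty_interpolant hL hv hε₁ hh0 hrel
  have h4 := (h1.add h2).add h3
  have e1 : ∫ x in Ioo 0 L, inner ℝ (yDeriv v x) (bDeriv v x) ^ 2
      = ∫ x in Ioo 0 L, inner ℝ (evalAt L x (tangentPair L v)) ((topPair L v).2 x) ^ 2 :=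
    integral_congr_ae ((yDeriv_ae_eq hL v).mono fun x hx => by
      simp only [hx]
      rfl)
  rw [penalizedEnergy, if_pos hv, e1]
  rw [zero_add, add_zero] at h4
  refine Tendsto.congr (fun n => ?_) ((continuous_coe_real_ereal.tendsto _).comp h4)
  rw [discreteEnergy, if_pos (interpolant_mem_discreteAdmissible hL hLbc hv (T n))]
  simp only [Function.comp_apply, EReal.coe_eq_coe_iff, bulkEnergy]
  ring

end Recovery

end Ribbon

end

theorem corollary4p5 {F : Type*} [NormedAddCommGroup F] [NormedSpace ℝ F]
    (L : ℝ) (hL : 0 < L)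
    (m : ℝ → ℝ → ℝ) (c₀ c₁ c₂ cuni : ℝ) (hm : Ribbon.IsRegularizedModulus m c₀ c₁ c₂ cuni)
    (Lbc : Ribbon.PairSpace L →L[ℝ] F)
    (hLbc : ∀ u v : Ribbon.PairSpace L,
      Ribbon.boundaryValues u = Ribbon.boundaryValues v → Lbc u = Lbc v)
    (lbc : F)
    (ε₂ : ℝ) (hε₂ : 0 < ε₂)
    (T : ℕ → Ribbon.Partition L)
    (c : ℝ) (hc : 0 < c) (hT : ∀ n j, c * (T n).meshSize ≤ (T n).elemSize j)
    (δ ε₁ : ℕ → ℝ) (hδ : ∀ n, 0 ≤ δ n) (hε₁ : ∀ n, 0 < ε₁ n)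
    (hδ0 : Tendsto δ atTop (𝓝 0)) (hε₁0 : Tendsto ε₁ atTop (𝓝 0))
    (hh0 : Tendsto (fun n => (T n).meshSize) atTop (𝓝 0))
    (hrel : Tendsto (fun n => (T n).meshSize ^ 2 / ε₁ n) atTop (𝓝 0)) :
    Ribbon.GammaConverges
      (fun n => Ribbon.discreteEnergy m Lbc lbc (δ n) (ε₁ n) ε₂ (T n))
      (Ribbon.penalizedEnergy L Lbc lbc ε₂) := by
  have hlower : ∀ (u : ℕ → Ribbon.PairSpace L) (v : Ribbon.PairSpace L),
      (∀ l : Ribbon.PairSpace L →L[ℝ] ℝ, Tendsto (fun n => l (u n)) atTop (𝓝 (l v))) →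
      Ribbon.penalizedEnergy L Lbc lbc ε₂ v
        ≤ liminf (fun n => Ribbon.discreteEnergy m Lbc lbc (δ n) (ε₁ n) ε₂ (T n) (u n)) atTop := by
    intro u v huv
    by_contra! hlt
    obtain ⟨a, ha1, ha2⟩ := EReal.lt_iff_exists_real_btwn.1 hlt
    -- along a subsequence the energies stay below `a`
    obtain ⟨φ, hφ, hφa⟩ := extraction_of_frequently_atTop (frequently_lt_of_liminf_lt (h := ha1))
    have hφt := hφ.tendsto_atTop
    exact absurd (Ribbon.penalizedEnergy_le_of_discreteEnergy_le hL hm Lbc lbc hε₂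
      (T := fun n => T (φ n)) (fun n => hδ (φ n)) (fun n => hε₁ (φ n)) (hδ0.comp hφt)
      (hε₁0.comp hφt) (hh0.comp hφt) (u := fun n => u (φ n)) (fun l => (huv l).comp hφt)
      fun n => (hφa n).le) (not_le.2 ha2)
  refine ⟨hlower, fun v => ?_⟩
  by_cases hv : v ∈ Ribbon.admissibleFrames L Lbc lbc
  · exact ⟨fun n => Ribbon.interpolant hL (T n) v, Ribbon.tendsto_interpolant hL hh0 v,
      Ribbon.tendsto_discreteEnergy_interpolant hL hm hLbc hε₂ hδ hε₁ hδ0 hh0 hrel hv⟩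
  · -- the lower bound makes the constant sequence a recovery sequence where the limit is infinite
    have htop : Ribbon.penalizedEnergy L Lbc lbc ε₂ v = ⊤ := if_neg hv
    have h := hlower (fun _ => v) v fun l => tendsto_const_nhds
    refine ⟨fun _ => v, tendsto_const_nhds, ?_⟩
    exact tendsto_of_le_liminf_of_limsup_le h (by rw [htop]; exact le_top)
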